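/- Let $n\ge 1$ and $f\in\mathcal S(\mathbb R^{2n})$ (complex-valued), write points of $\mathbb R^{2n}$ as $(x,y)$ with $x,y\in\mathbb R^n$, and let $\widehat f(\xi,\eta)=\int_{\mathbb R^n\times\mathbb R^n} e^{2\pi i(x\cdot\xi+y\cdot\eta)}f(x,y)\,dx\,dy$. (a) For $0<\lambda<n$, both integrals below are finite and $$\int_{\mathbb R^n\times\mathbb R^n}|x-y|^{-\lambda}|f(x,y)|^2\,dx\,dy\le F_\lambda\int_{\mathbb R^n\times\mathbb R^n}|\xi-\eta|^{\lambda}|\widehat f(\xi,\eta)|^2\,d\xi\,d\eta,\qquad F_\lambda=\Big(\frac{\pi}{2}\Big)^{\lambda}\left[\frac{\Gamma(\frac{n-\lambda}{4})}{\Gamma(\frac{n+\lambda}{4})}\right]^2 .$$ (b) For $0<\lambda<\min(2,n)$, $$\int_{\mathbb R^n\times\mathbb R^n}|x-y|^{-\lambda}|f(x,y)|^2\,dx\,dy\le G_\lambda\int_{\mathbb R^{2n}}\int_{\{(u,v)\in\mathbb R^{2n}:\,u+v=x+y\}}|x-y-u+v|^{-n-\lambda}\,|f(x,y)-f(u,v)|^2\,d\sigma(u,v)\,dx\,dy,$$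 $$G_\lambda=\Big(\frac{\pi}{2}\Big)^{-n/2}\,\frac{\lambda}{4}\,\frac{\Gamma(\frac{n+\lambda}{2})}{\Gamma(1-\frac{\lambda}{2})}\left[\frac{\Gamma(\frac{n-\lambda}{4})}{\Gamma(\frac{n+\lambda}{4})}\right]^2,$$ where $\sigma$ is $n$-dimensional Lebesgue measure on the $n$-plane $u+v=x+y$, that is, $(u,v)=(x+s/\sqrt2,\;y-s/\sqrt2)$ with $d\sigma=ds$, $s\in\mathbb R^n$; the right-hand side is finite. The inequality also holds, in $[0,\infty]$, with the integral on the right replaced by $\int_{\mathbb R^{2n}\times\mathbb R^{2n}}|x-y-u+v|^{-n-\lambda}|f(x,y)-f(u,v)|^2\,dx\,dy\,du\,dv$. (c) (Logarithmic uncertainty) The integrals below converge absolutely and $$\int_{\mathbb R^n\times\mathbb R^n}\ln|x-y|\,|f(x,y)|^2\,dx\,dy+\int_{\mathbb R^n\times\mathbb R^n}\ln|\xi-\eta|\,|\widehat f(\xi,\eta)|^2\,d\xi\,d\eta\ \ge\ \Big[\psi\Big(\frac n4\Big)-\ln\frac{\pi}{2}\Big]\int_{\mathbb R^n\times\mathbb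 R^n}|f(x,y)|^2\,dx\,dy,\qquad \psi=(\ln\Gamma)'.$$ -/

import Mathlib

open MeasureTheory
open scoped SchwartzMap

namespace PittAS

noncomputable section

/-- Euclidean `n`-space. -/
abbrev E (n : ℕ) : Type := EuclideanSpace ℝ (Fin n)

/-- The Fourier transform on `ℝⁿ × ℝⁿ`, with the convention
`f̂(ξ, η) = ∫ exp(2πi (x·ξ + y·η)) f(x, y) dx dy`. -/
def fourier {n : ℕ} (f : E n × E n → ℂ) (w : E n × E n) : ℂ :=
  ∫ z : E n × E n,
    Complex.exp (2 * Real.pi * Complex.I *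
      ((inner ℝ z.1 w.1 + inner ℝ z.2 w.2 : ℝ) : ℂ)) * f z

/-- `|x - y|^(-lam) |f(x, y)|²`. -/
def potentialDensity {n : ℕ} (lam : ℝ) (f : E n × E n → ℂ) (z : E n × E n) : ℝ :=
  ‖z.1 - z.2‖ ^ (-lam) * ‖f z‖ ^ 2

/-- `|ξ - η|^lam |f̂(ξ, η)|²`. -/
def frequencyDensity {n : ℕ} (lam : ℝ) (f : E n × E n → ℂ) (w : E n × E n) : ℝ :=
  ‖w.1 - w.2‖ ^ lam * ‖fourier f w‖ ^ 2

/-- For `z = (x, y)` and `z' = (u, v)`: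
`|x - y - u + v|^(-n-lam) |f(x, y) - f(u, v)|²`. -/
def differenceDensity {n : ℕ} (lam : ℝ) (f : E n × E n → ℂ) (z z' : E n × E n) : ℝ :=
  ‖z.1 - z.2 - z'.1 + z'.2‖ ^ (-(n : ℝ) - lam) * ‖f z - f z'‖ ^ 2

/-- The isometric parametrization `s ↦ (x + s/√2, y - s/√2)`, `s ∈ ℝⁿ`, of the `n`-plane
`{(u, v) : u + v = x + y}` through `z = (x, y)`; it carries Lebesgue measure on `ℝⁿ` to the
`n`-dimensional Euclidean surface measure of that plane. -/
def planePoint {n : ℕ} (z : E n × E n) (s : E n) : E n × E n :=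
  (z.1 + (Real.sqrt 2)⁻¹ • s, z.2 - (Real.sqrt 2)⁻¹ • s)

/-- `F_lam = (π/2)^lam [Γ((n-lam)/4) / Γ((n+lam)/4)]²`. -/
def constF (n : ℕ) (lam : ℝ) : ℝ :=
  (Real.pi / 2) ^ lam * (Real.Gamma ((n - lam) / 4) / Real.Gamma ((n + lam) / 4)) ^ 2

/-- `G_lam = (π/2)^(-n/2) (lam/4) Γ((n+lam)/2) / Γ(1-lam/2) [Γ((n-lam)/4) / Γ((n+lam)/4)]²`. -/
def constG (n : ℕ) (lam : ℝ) : ℝ :=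
  (Real.pi / 2) ^ (-(n : ℝ) / 2) * (lam / 4) *
    (Real.Gamma ((n + lam) / 2) / Real.Gamma (1 - lam / 2)) *
    (Real.Gamma ((n - lam) / 4) / Real.Gamma ((n + lam) / 4)) ^ 2

/-- The digamma function `ψ = (ln Γ)'` (used on positive reals). -/
def psi (t : ℝ) : ℝ := deriv (fun r : ℝ => Real.log (Real.Gamma r)) t

end

end PittAS

namespace PittAS

open Set ENNReal
open scoped FourierTransform ComplexConjugate

variable {n : ℕ}

/-! ### One-dimensional integrals -/

/-! Everything happens in the difference variable: multiplying `f` by a function of `x - y` acts on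
the Fourier side by translations along the antidiagonal `(ζ, -ζ)`.

For (a), `|x-y|^(-λ)` is a superposition of Gaussians `exp(-π t |x-y|²)`. Parseval turns each
Gaussian into a heat-kernel average of `∫ f̂(w + (ζ,-ζ)) conj f̂(w) dw`
(`lintegral_gaussian_norm_sq_le`), and integrating in `t` turns the heat kernels into the Riesz
kernel `riesz (λ/2)`. After taking absolute values, what remains is a positive quadratic form in
`|f̂|`, bounded by Schur's test (`lintegral_schur`) with weight `riesz β`, `β = (n-λ)/4`, in the
variable `(ξ-η)/2`. The composition law `lintegral_riesz_mul_riesz` evaluates the test exactly: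
`riesz (λ/2 + β) / riesz β` is a multiple of `|ξ-η|^λ`, and the constants multiply to `F_λ`.

For (b), Plancherel in `(x,y)` for each fixed `s`, followed by the integral of `|s|^(-n-λ) (2 - 2
cos(2π d·s))`, which is a multiple of `|d|^λ`, shows that `G_λ` times the plane functional equals
`F_λ` times the frequency integral; so (b) is (a) rewritten. With the integral over all of `ℝ²ⁿ ×
ℝ²ⁿ` the statement is soft: the kernel is constant along diagonal directions, so the right side is
infinite unless `f = 0`.

For (c), the difference of the two sides of (a) vanishes at `λ = 0` by Plancherel and is nonnegative
for small `λ > 0`; hence its derivative at `0` is nonnegative, and that derivative is the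
logarithmic inequality. -/

lemma lintegral_ofReal_eq_of_integral_ne_zero {α : Type*} [MeasurableSpace α] {μ : Measure α}
    {f : α → ℝ} {c : ℝ} (hf : 0 ≤ᵐ[μ] f) (h : ∫ x, f x ∂μ = c) (hc : c ≠ 0) :
    ∫⁻ x, ENNReal.ofReal (f x) ∂μ = ENNReal.ofReal c := by
  -- A nonzero Bochner integral certifies integrability, since the default value for non-integrable
  -- functions is 0.
  rw [← h, ofReal_integral_eq_lintegral_ofReal (.of_integral_ne_zero (h ▸ hc)) hf]

lemma lintegral_rpow_mul_exp_neg {a r : ℝ} (ha : 0 < a) (hr : 0 < r) :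
    ∫⁻ t in Ioi (0 : ℝ), ENNReal.ofReal (t ^ (a - 1) * Real.exp (-(r * t))) =
      ENNReal.ofReal (r ^ (-a) * Real.Gamma a) := by
  refine lintegral_ofReal_eq_of_integral_ne_zero ?_ ?_ ?_
  · filter_upwards [ae_restrict_mem measurableSet_Ioi] with t ht
    have : (0 : ℝ) < t := ht
    simp only [Pi.zero_apply]; positivity
  · rw [Real.integral_rpow_mul_exp_neg_mul_Ioi ha hr, one_div, Real.inv_rpow hr.le,
      Real.rpow_neg hr.le]
  · have := Real.Gamma_pos_of_pos ha
    positivity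

lemma image_inv_Ioi : (fun t : ℝ => t⁻¹) '' Ioi 0 = Ioi 0 := by
  ext t
  simp only [Set.mem_image, Set.mem_Ioi]
  exact ⟨fun ⟨x, hx, h⟩ => h ▸ inv_pos.2 hx, fun h => ⟨t⁻¹, inv_pos.2 h, inv_inv t⟩⟩

/-- The substitution `t ↦ 1/t` in the Gamma integral. This is the form in which heat kernels
integrate to Riesz kernels. -/
lemma lintegral_rpow_mul_exp_neg_div {a r : ℝ} (ha : 0 < a) (hr : 0 < r) :
    ∫⁻ t in Ioi (0 : ℝ), ENNReal.ofReal (t ^ (-a - 1) * Real.exp (-(r / t))) =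
      ENNReal.ofReal (r ^ (-a) * Real.Gamma a) := by
  rw [← lintegral_rpow_mul_exp_neg ha hr]
  conv_rhs => rw [← image_inv_Ioi]
  rw [lintegral_image_eq_lintegral_abs_deriv_mul (f' := fun t => -(t ^ 2)⁻¹) measurableSet_Ioi
    (fun x hx => (hasDerivAt_inv (ne_of_gt hx)).hasDerivWithinAt) inv_injective.injOn]
  refine setLIntegral_congr_fun measurableSet_Ioi fun t ht => ?_
  have ht : (0 : ℝ) < t := ht
  rw [← ENNReal.ofReal_mul (abs_nonneg _), ← mul_assoc]
  congr 2
  rw [abs_neg, abs_of_pos (by positivity), Real.inv_rpow ht.le, ← Real.rpow_neg ht.le,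
    ← Real.rpow_natCast, ← Real.rpow_neg ht.le, ← Real.rpow_add ht]
  congr 1; push_cast; ring

/-- `t ↦ t₊ ^ (a - 1)`, with values in `[0, ∞]`. -/
noncomputable def powKernel (a t : ℝ) : ℝ≥0∞ :=
  (Ioi (0 : ℝ)).indicator (fun t => ENNReal.ofReal (t ^ (a - 1))) t

@[fun_prop]
lemma measurable_powKernel (a : ℝ) : Measurable (powKernel a) :=
  Measurable.indicator (by fun_prop) measurableSet_Ioi

lemma lintegral_powKernel_mul (a : ℝ) (Φ : ℝ → ℝ≥0∞) :
    ∫⁻ t, powKernel a t * Φ t = ∫⁻ t in Ioi (0 : ℝ), ENNReal.ofReal (t ^ (a - 1)) * Φ t := by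
  rw [← lintegral_indicator measurableSet_Ioi]
  congr 1; ext t
  simp only [powKernel, indicator]
  split_ifs <;> simp

lemma powKernel_mul {a r : ℝ} (hr : 0 < r) (s : ℝ) :
    powKernel a (r * s) = ENNReal.ofReal (r ^ (a - 1)) * powKernel a s := by
  by_cases hs : 0 < s
  · simp only [powKernel, indicator, Set.mem_Ioi, hs, mul_pos hr hs, if_true]
    rw [Real.mul_rpow hr.le hs.le, ENNReal.ofReal_mul (by positivity)]
  · have : ¬ 0 < r * s := fun h => hs (pos_of_mul_pos_right h hr.le)
    simp [powKernel, indicator, hs, this]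

lemma lintegral_comp_mul_left_pos {r : ℝ} (hr : 0 < r) (g : ℝ → ℝ≥0∞) :
    ∫⁻ t, g t = ENNReal.ofReal r * ∫⁻ t, g (r * t) := by
  have h := lintegral_image_eq_lintegral_abs_deriv_mul (s := univ) (f := fun t => r * t)
    (f' := fun _ => r) MeasurableSet.univ
    (fun x _ => (by simpa using (hasDerivAt_id x).const_mul r :
      HasDerivAt (fun t => r * t) r x).hasDerivWithinAt)
    (mul_right_injective₀ hr.ne').injOn g
  rw [image_univ_of_surjective (mul_left_surjective₀ hr.ne')] at h
  simp only [setLIntegral_univ, abs_of_pos hr] at h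
  rw [h, lintegral_const_mul' _ _ ofReal_ne_top]

/-- Scaling `t ↦ r t` extracts the power of `r`; for `r ≤ 0` the supports `t > 0` and `t < r` are
disjoint. The Beta constant stays an unevaluated integral here. -/
lemma lintegral_powKernel_conv (a b r : ℝ) :
    ∫⁻ t, powKernel a t * powKernel b (r - t) =
      powKernel (a + b) r * ∫⁻ t, powKernel a t * powKernel b (1 - t) := by
  by_cases hr : 0 < r
  · rw [lintegral_comp_mul_left_pos hr]
    have : ∀ t, powKernel a (r * t) * powKernel b (r - r * t) =
        ENNReal.ofReal (r ^ (a - 1) * r ^ (b - 1)) * (powKernel a t * powKernel b (1 - t)) := by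
      intro t
      rw [show r - r * t = r * (1 - t) by ring, powKernel_mul hr, powKernel_mul hr,
        ENNReal.ofReal_mul (by positivity)]
      ring
    simp only [this]
    rw [lintegral_const_mul' _ _ ofReal_ne_top, ← mul_assoc, ← ENNReal.ofReal_mul hr.le]
    congr 1
    simp only [powKernel, indicator, Set.mem_Ioi, hr, if_true]
    congr 1
    rw [← Real.rpow_add hr]
    nth_rewrite 1 [← Real.rpow_one r]
    rw [← Real.rpow_add hr]
    congr 1; ring
  · rw [show powKernel (a + b) r = 0 by simp [powKernel, indicator, hr], zero_mul]
    refine (lintegral_congr fun t => ?_).trans lintegral_zero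
    by_cases ht : 0 < t
    · have : ¬ t < r := by linarith
      simp [powKernel, indicator, this]
    · simp [powKernel, indicator, ht]

lemma lintegral_powKernel_powKernel_aux (a b : ℝ) {Φ : ℝ → ℝ≥0∞} (hΦ : Measurable Φ) :
    ∫⁻ t, ∫⁻ u, powKernel a t * powKernel b u * Φ (t + u) =
      (∫⁻ t, powKernel a t * powKernel b (1 - t)) * ∫⁻ r, powKernel (a + b) r * Φ r := by
  have ma := measurable_powKernel a
  have mb := measurable_powKernel b
  have mab := measurable_powKernel (a + b)
  have h1 : ∀ t, ∫⁻ u, powKernel a t * powKernel b u * Φ (t + u) =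
      ∫⁻ r, powKernel a t * powKernel b (r - t) * Φ r := by
    intro t
    rw [← lintegral_sub_right_eq_self _ t]
    simp
  simp only [h1]
  rw [lintegral_lintegral_swap (by fun_prop)]
  have h2 : ∀ r, ∫⁻ t, powKernel a t * powKernel b (r - t) * Φ r =
      (∫⁻ t, powKernel a t * powKernel b (1 - t)) * (powKernel (a + b) r * Φ r) := by
    intro r
    rw [lintegral_mul_const _ (by fun_prop), lintegral_powKernel_conv]
    ring
  simp only [h2]
  rw [lintegral_const_mul _ (by fun_prop)]

lemma lintegral_powKernel_exp {a : ℝ} (ha : 0 < a) :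
    ∫⁻ t, powKernel a t * ENNReal.ofReal (Real.exp (-t)) = ENNReal.ofReal (Real.Gamma a) := by
  rw [lintegral_powKernel_mul]
  have := lintegral_rpow_mul_exp_neg ha one_pos
  simp only [Real.one_rpow, one_mul] at this
  rw [← this]
  refine setLIntegral_congr_fun measurableSet_Ioi fun t ht => ?_
  have ht : (0 : ℝ) < t := ht
  rw [← ENNReal.ofReal_mul (by positivity)]

/-- Euler's beta integral, in the form of the semigroup law of fractional integration. -/
lemma lintegral_powKernel_powKernel {a b : ℝ} (ha : 0 < a) (hb : 0 < b) {Φ : ℝ → ℝ≥0∞}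
    (hΦ : Measurable Φ) :
    ∫⁻ t, ∫⁻ u, powKernel a t * powKernel b u * Φ (t + u) =
      ENNReal.ofReal (Real.Gamma a * Real.Gamma b / Real.Gamma (a + b)) *
        ∫⁻ r, powKernel (a + b) r * Φ r := by
  rw [lintegral_powKernel_powKernel_aux a b hΦ]
  congr 1
  have ga := Real.Gamma_pos_of_pos ha
  have gb := Real.Gamma_pos_of_pos hb
  have gab := Real.Gamma_pos_of_pos (add_pos ha hb)
  -- The unknown constant is found by testing on `exp(-·)`, which factors over `t + u` and reduces
  -- every integral to a Gamma function.
  have h := lintegral_powKernel_powKernel_aux a b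
    (Φ := fun t => ENNReal.ofReal (Real.exp (-t))) (by fun_prop)
  rw [lintegral_powKernel_exp (add_pos ha hb)] at h
  have h3 : ∀ t, ∫⁻ u, powKernel a t * powKernel b u * ENNReal.ofReal (Real.exp (-(t + u))) =
      powKernel a t * ENNReal.ofReal (Real.exp (-t)) * ENNReal.ofReal (Real.Gamma b) := by
    intro t
    have mb := measurable_powKernel b
    rw [← lintegral_powKernel_exp hb, ← lintegral_const_mul _ (by fun_prop)]
    refine lintegral_congr fun u => ?_
    rw [neg_add, Real.exp_add, ENNReal.ofReal_mul (by positivity)]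
    ring
  simp only [h3] at h
  have ma := measurable_powKernel a
  rw [lintegral_mul_const _ (by fun_prop), lintegral_powKernel_exp ha, ← ENNReal.ofReal_mul ga.le] at h
  rw [ENNReal.ofReal_div_of_pos gab, h, ENNReal.mul_div_cancel_right
    (by simpa using gab) ofReal_ne_top]

lemma lintegral_Ioo_rpow {a c : ℝ} (ha : 0 < a) (hc : 0 < c) :
    ∫⁻ t in Ioo 0 c, ENNReal.ofReal (t ^ (a - 1)) = ENNReal.ofReal (c ^ a / a) := by
  refine lintegral_ofReal_eq_of_integral_ne_zero ?_ ?_ (by positivity)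
  · filter_upwards [ae_restrict_mem measurableSet_Ioo] with t ht
    have : (0 : ℝ) < t := ht.1
    simp only [Pi.zero_apply]; positivity
  · rw [← integral_Ioc_eq_integral_Ioo, ← intervalIntegral.integral_of_le hc.le,
      integral_rpow (Or.inl (by linarith))]
    simp [Real.zero_rpow ha.ne']

lemma lintegral_Ioo_exp_neg {B c : ℝ} (hB : 0 < B) (hc : 0 < c) :
    ∫⁻ r in Ioo 0 c, ENNReal.ofReal (B * Real.exp (-(B * r))) =
      ENNReal.ofReal (1 - Real.exp (-(B * c))) := by
  have h0 : Real.exp (-(B * c)) < 1 := Real.exp_lt_one_iff.2 (by nlinarith [mul_pos hB hc])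
  refine lintegral_ofReal_eq_of_integral_ne_zero
    (ae_of_all _ fun r => by simp only [Pi.zero_apply]; positivity) ?_ (by linarith)
  rw [← integral_Ioc_eq_integral_Ioo, ← intervalIntegral.integral_of_le hc.le]
  rw [intervalIntegral.integral_eq_sub_of_hasDerivAt (f := fun r => -Real.exp (-(B * r)))]
  · simp; ring
  · intro x _
    have := (((hasDerivAt_id x).const_mul B).neg.exp).neg
    simp only [id, mul_one, mul_neg, neg_neg] at this
    rw [mul_comm]; exact this
  · exact (Continuous.intervalIntegrable (by fun_prop) _ _)

/-- Write `1 - exp(-B/t)` as the integral of `B exp(-B r)` over `0 < r < 1/t` and apply Tonelli on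
`r t < 1`: the `t`-integral gives `r^(-a)/a`, leaving a Gamma integral of order `1 - a`. The factors
`powKernel 1` serve as indicators of the half-line. -/
lemma lintegral_rpow_mul_one_sub_exp {a B : ℝ} (ha : 0 < a) (ha' : a < 1) (hB : 0 < B) :
    ∫⁻ t in Ioi (0 : ℝ), ENNReal.ofReal (t ^ (a - 1) * (1 - Real.exp (-(B / t)))) =
      ENNReal.ofReal (a⁻¹ * B ^ a * Real.Gamma (1 - a)) := by
  have h1 : ∫⁻ t in Ioi (0 : ℝ), ENNReal.ofReal (t ^ (a - 1) * (1 - Real.exp (-(B / t)))) =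
      ∫⁻ t, ∫⁻ r, powKernel a t * (powKernel 1 r * (powKernel 1 (1 - r * t) *
        ENNReal.ofReal (B * Real.exp (-(B * r))))) := by
    have ma := measurable_powKernel 1
    have : ∀ t, ∫⁻ r, powKernel a t * (powKernel 1 r * (powKernel 1 (1 - r * t) *
        ENNReal.ofReal (B * Real.exp (-(B * r))))) = powKernel a t *
        ∫⁻ r, powKernel 1 r * (powKernel 1 (1 - r * t) *
        ENNReal.ofReal (B * Real.exp (-(B * r)))) := fun t =>
      lintegral_const_mul _ (by fun_prop)
    simp only [this]
    rw [lintegral_powKernel_mul]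
    refine setLIntegral_congr_fun measurableSet_Ioi fun t ht => ?_
    have ht : (0 : ℝ) < t := ht
    rw [ENNReal.ofReal_mul (by positivity)]
    congr 1
    have := lintegral_Ioo_exp_neg hB (inv_pos.2 ht)
    rw [← div_eq_mul_inv] at this
    rw [← this, ← lintegral_indicator measurableSet_Ioo]
    refine lintegral_congr fun r => ?_
    have e : r < t⁻¹ ↔ r * t < 1 := by rw [← one_div, lt_div_iff₀ ht]
    by_cases h1 : 0 < r <;> by_cases h2 : r * t < 1 <;> simp [powKernel, indicator, h1, h2, e]
  have h2 : ∀ r, ∫⁻ t, powKernel a t * (powKernel 1 r * (powKernel 1 (1 - r * t) *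
        ENNReal.ofReal (B * Real.exp (-(B * r))))) =
      powKernel 1 r * ENNReal.ofReal (B * Real.exp (-(B * r)) * ((r⁻¹) ^ a / a)) := by
    intro r
    by_cases hr : 0 < r
    · rw [ENNReal.ofReal_mul (p := B * _) (by positivity), ← lintegral_Ioo_rpow ha (inv_pos.2 hr),
        ← lintegral_indicator measurableSet_Ioo, ← mul_assoc, ← lintegral_const_mul]
      · refine lintegral_congr fun t => ?_
        have e : t < r⁻¹ ↔ r * t < 1 := by rw [← one_div, lt_div_iff₀ hr, mul_comm]
        by_cases h1 : 0 < t <;> by_cases h2 : r * t < 1 <;>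
          simp [powKernel, indicator, h1, h2, e, hr, mul_comm]
      · exact Measurable.indicator (by fun_prop) measurableSet_Ioo
    · simp [powKernel, indicator, hr]
  have ma := measurable_powKernel a
  have m1 := measurable_powKernel 1
  rw [h1, lintegral_lintegral_swap (by fun_prop)]
  simp only [h2]
  rw [lintegral_powKernel_mul]
  have h3 := lintegral_rpow_mul_exp_neg (a := 1 - a) (by linarith) hB
  calc _ = ∫⁻ t in Ioi (0 : ℝ), ENNReal.ofReal (B / a) *
        ENNReal.ofReal (t ^ (1 - a - 1) * Real.exp (-(B * t))) := by
        refine setLIntegral_congr_fun measurableSet_Ioi fun t ht => ?_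
        have ht : (0 : ℝ) < t := ht
        rw [← ENNReal.ofReal_mul (by positivity), ← ENNReal.ofReal_mul (by positivity)]
        congr 1
        rw [Real.inv_rpow ht.le, ← Real.rpow_neg ht.le]
        rw [show 1 - a - 1 = -a by ring, sub_self, Real.rpow_zero]; ring
    _ = _ := by
        rw [lintegral_const_mul _ (by fun_prop), h3, ← ENNReal.ofReal_mul (by positivity)]
        congr 1
        rw [show -(1 - a) = a - 1 by ring, Real.rpow_sub_one hB.ne']
        field_simp

/-! ### The heat kernel -/

/-- The heat kernel `t^(-n/2) exp(-π |v|² / t)` on `ℝⁿ`. -/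
noncomputable def heat (t : ℝ) (v : E n) : ℝ :=
  t ^ (-(n : ℝ) / 2) * Real.exp (-(Real.pi * ‖v‖ ^ 2 / t))

lemma heat_nonneg {t : ℝ} (ht : 0 < t) (v : E n) : 0 ≤ heat t v := by
  unfold heat; positivity

lemma heat_neg (t : ℝ) (v : E n) : heat t (-v) = heat t v := by simp [heat]

@[fun_prop]
lemma measurable_heat {γ : Type*} [MeasurableSpace γ] {f : γ → ℝ} {g : γ → E n}
    (hf : Measurable f) (hg : Measurable g) : Measurable fun x => heat (f x) (g x) := by
  unfold heat; fun_prop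

lemma integrable_gaussian {b : ℝ} (hb : 0 < b) :
    Integrable fun v : E n => Real.exp (-b * ‖v‖ ^ 2) := by
  refine .of_integral_ne_zero ?_
  rw [GaussianFourier.integral_rexp_neg_mul_sq_norm hb]
  positivity

lemma integrable_heat {t : ℝ} (ht : 0 < t) : Integrable (heat t : E n → ℝ) := by
  refine ((integrable_gaussian (n := n) (b := Real.pi / t) (by positivity)).const_mul
    (t ^ (-(n : ℝ) / 2))).congr (ae_of_all _ fun v => ?_)
  simp only [heat]; congr 2; ring

/-- Completing the square in `z`: the product is a Gaussian centred at `-(t/(t+u)) v`, times a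
factor free of `z`. -/
lemma heat_mul_heat {t u : ℝ} (ht : 0 < t) (hu : 0 < u) (v z : E n) :
    heat t z * heat u (v + z) = heat (t + u) v *
      ((t * u / (t + u)) ^ (-(n : ℝ) / 2) *
        Real.exp (-(Real.pi * (t + u) / (t * u)) * ‖z + (t / (t + u)) • v‖ ^ 2)) := by
  have htu : 0 < t + u := add_pos ht hu
  have h1 : t ^ (-(n : ℝ) / 2) * u ^ (-(n : ℝ) / 2) =
      (t + u) ^ (-(n : ℝ) / 2) * (t * u / (t + u)) ^ (-(n : ℝ) / 2) := by
    rw [← Real.mul_rpow ht.le hu.le, ← Real.mul_rpow htu.le (by positivity)]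
    congr 1; field_simp
  have h2 : Real.exp (-(Real.pi * ‖z‖ ^ 2 / t)) * Real.exp (-(Real.pi * ‖v + z‖ ^ 2 / u)) =
      Real.exp (-(Real.pi * ‖v‖ ^ 2 / (t + u))) *
        Real.exp (-(Real.pi * (t + u) / (t * u)) * ‖z + (t / (t + u)) • v‖ ^ 2) := by
    rw [← Real.exp_add, ← Real.exp_add]
    congr 1
    rw [norm_add_sq_real, norm_add_sq_real, norm_smul, inner_smul_right, real_inner_comm,
      Real.norm_of_nonneg (by positivity)]
    field_simp
    ring
  unfold heat
  calc _ = (t ^ (-(n : ℝ) / 2) * u ^ (-(n : ℝ) / 2)) *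
      (Real.exp (-(Real.pi * ‖z‖ ^ 2 / t)) * Real.exp (-(Real.pi * ‖v + z‖ ^ 2 / u))) := by ring
    _ = _ := by rw [h1, h2]; ring

/-- The semigroup law of the heat kernel. -/
lemma lintegral_heat_mul_heat {t u : ℝ} (ht : 0 < t) (hu : 0 < u) (v : E n) :
    ∫⁻ z, ENNReal.ofReal (heat t z) * ENNReal.ofReal (heat u (v + z)) =
      ENNReal.ofReal (heat (t + u) v) := by
  have htu : 0 < t + u := add_pos ht hu
  simp only [← ENNReal.ofReal_mul (heat_nonneg ht _), heat_mul_heat ht hu]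
  rw [lintegral_ofReal_eq_of_integral_ne_zero (c := heat (t + u) v)]
  · refine ae_of_all _ fun z => ?_
    have := heat_nonneg htu v
    simp only [Pi.zero_apply]; positivity
  · rw [integral_const_mul, integral_const_mul, integral_add_right_eq_self
      (fun z : E n => Real.exp (-(Real.pi * (t + u) / (t * u)) * ‖z‖ ^ 2)),
      GaussianFourier.integral_rexp_neg_mul_sq_norm (by positivity)]
    rw [show Real.pi / (Real.pi * (t + u) / (t * u)) = t * u / (t + u) by field_simp,
      finrank_euclideanSpace_fin, ← Real.rpow_add (by positivity)]
    simp [neg_div]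
  · unfold heat; positivity

lemma integral_heat_mul_cexp {t : ℝ} (ht : 0 < t) (d : E n) :
    ∫ z : E n, (heat t z : ℂ) * Complex.exp (2 * Real.pi * Complex.I * (inner ℝ d z : ℝ)) =
      Complex.exp (-(Real.pi * t * ‖d‖ ^ 2 : ℝ)) := by
  have h := GaussianFourier.integral_cexp_neg_mul_sq_norm_add (b := (Real.pi / t : ℝ))
    (by rw [Complex.ofReal_re]; positivity) (2 * Real.pi * Complex.I) d
  have h1 : ∀ z : E n, (heat t z : ℂ) *
      Complex.exp (2 * Real.pi * Complex.I * (inner ℝ d z : ℝ)) =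
      ((t ^ (-(n : ℝ) / 2) : ℝ) : ℂ) * Complex.exp (-(Real.pi / t : ℝ) * (‖z‖ : ℂ) ^ 2 +
        2 * Real.pi * Complex.I * (inner ℝ d z : ℝ)) := by
    intro z
    rw [Complex.exp_add, ← mul_assoc]
    congr 1
    simp only [heat]
    push_cast
    congr 2
    ring
  simp only [h1]
  rw [integral_const_mul, h, ← mul_assoc, finrank_euclideanSpace_fin]
  have h2 : (Real.pi : ℂ) / ((Real.pi / t : ℝ) : ℂ) = (t : ℂ) := by
    have : (Real.pi : ℂ) ≠ 0 := by exact_mod_cast Real.pi_ne_zero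
    have : (t : ℂ) ≠ 0 := by exact_mod_cast ht.ne'
    push_cast; field_simp
  rw [h2]
  have h3 : ((t ^ (-(n : ℝ) / 2) : ℝ) : ℂ) * (t : ℂ) ^ ((n : ℂ) / 2) = 1 := by
    rw [show ((n : ℂ) / 2) = (((n : ℝ) / 2 : ℝ) : ℂ) by push_cast; ring,
      ← Complex.ofReal_cpow ht.le, ← Complex.ofReal_mul, ← Real.rpow_add ht]
    simp [neg_div]
  rw [h3, one_mul]
  congr 1
  have : (Real.pi : ℂ) ≠ 0 := by exact_mod_cast Real.pi_ne_zero
  have : (t : ℂ) ≠ 0 := by exact_mod_cast ht.ne'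
  push_cast
  field_simp
  rw [Complex.I_sq]; ring

lemma lintegral_gaussian_mul_one_sub_cos {t : ℝ} (ht : 0 < t) (d : E n) :
    ∫⁻ z : E n, ENNReal.ofReal (Real.exp (-(Real.pi * t * ‖z‖ ^ 2)) *
        (2 - 2 * Real.cos (2 * Real.pi * inner ℝ d z))) =
      ENNReal.ofReal (2 * t ^ (-(n : ℝ) / 2) * (1 - Real.exp (-(Real.pi * ‖d‖ ^ 2 / t)))) := by
  have hg : Integrable fun z : E n => Real.exp (-(Real.pi * t * ‖z‖ ^ 2)) := by
    simpa using integrable_gaussian (n := n) (b := Real.pi * t) (by positivity)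
  have hgc : Integrable fun z : E n => Real.exp (-(Real.pi * t * ‖z‖ ^ 2)) *
      Real.cos (2 * Real.pi * inner ℝ d z) :=
    hg.mul_bdd (c := 1) (by fun_prop) (ae_of_all _ fun z => Real.abs_cos_le_one _)
  have h0 : ∫ z : E n, Real.exp (-(Real.pi * t * ‖z‖ ^ 2)) = t ^ (-(n : ℝ) / 2) := by
    have := GaussianFourier.integral_rexp_neg_mul_sq_norm (V := E n) (b := Real.pi * t)
      (by positivity)
    simp only [neg_mul] at this
    rw [this, finrank_euclideanSpace_fin, show Real.pi / (Real.pi * t) = t⁻¹ by field_simp,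
      Real.inv_rpow ht.le, ← Real.rpow_neg ht.le, neg_div]
  have h1 : ∫ z : E n, Real.exp (-(Real.pi * t * ‖z‖ ^ 2)) *
      Real.cos (2 * Real.pi * inner ℝ d z) =
      t ^ (-(n : ℝ) / 2) * Real.exp (-(Real.pi * ‖d‖ ^ 2 / t)) := by
    -- Up to the factor `t^(n/2)`, `exp(-π t |z|²)` is the heat kernel at time `1/t`; the cosine
    -- integral is the real part of its Fourier transform.
    have h := integral_heat_mul_cexp (inv_pos.2 ht) d
    have hi : Integrable fun z : E n => (heat t⁻¹ z : ℂ) *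
        Complex.exp (2 * Real.pi * Complex.I * (inner ℝ d z : ℝ)) := by
      refine .of_integral_ne_zero ?_
      rw [h]; exact Complex.exp_ne_zero _
    have h2 := congrArg Complex.re h
    have h3 : ∀ z : E n, ((heat t⁻¹ z : ℂ) *
        Complex.exp (2 * Real.pi * Complex.I * (inner ℝ d z : ℝ))).re =
        t ^ ((n : ℝ) / 2) * (Real.exp (-(Real.pi * t * ‖z‖ ^ 2)) *
          Real.cos (2 * Real.pi * inner ℝ d z)) := by
      intro z
      rw [Complex.re_ofReal_mul, show 2 * Real.pi * Complex.I * ((inner ℝ d z : ℝ) : ℂ) =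
        ((2 * Real.pi * inner ℝ d z : ℝ) : ℂ) * Complex.I by push_cast; ring,
        Complex.exp_ofReal_mul_I_re, heat, Real.inv_rpow ht.le, ← Real.rpow_neg ht.le, neg_div,
        neg_neg, div_inv_eq_mul, mul_assoc]
      congr 4; ring
    have h4 : (∫ z : E n, (heat t⁻¹ z : ℂ) *
        Complex.exp (2 * Real.pi * Complex.I * (inner ℝ d z : ℝ))).re =
        ∫ z : E n, ((heat t⁻¹ z : ℂ) *
        Complex.exp (2 * Real.pi * Complex.I * (inner ℝ d z : ℝ))).re :=
      (integral_re hi).symm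
    rw [h4, ← Complex.ofReal_neg, Complex.exp_ofReal_re] at h2
    simp only [h3] at h2
    rw [integral_const_mul] at h2
    rw [neg_div, Real.rpow_neg ht.le, eq_inv_mul_iff_mul_eq₀ (by positivity), h2]
    congr 2; field_simp
  rw [← ofReal_integral_eq_lintegral_ofReal]
  · congr 1
    have : ∀ z : E n, Real.exp (-(Real.pi * t * ‖z‖ ^ 2)) *
        (2 - 2 * Real.cos (2 * Real.pi * inner ℝ d z)) =
        2 * Real.exp (-(Real.pi * t * ‖z‖ ^ 2)) - 2 * (Real.exp (-(Real.pi * t * ‖z‖ ^ 2)) *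
        Real.cos (2 * Real.pi * inner ℝ d z)) := fun z => by ring
    simp only [this]
    rw [integral_sub (hg.const_mul 2) (hgc.const_mul 2), integral_const_mul, integral_const_mul,
      h0, h1]
    ring
  · refine ((hg.const_mul 2).sub (hgc.const_mul 2)).congr (ae_of_all _ fun z => ?_)
    simp only [Pi.sub_apply]; ring
  · refine ae_of_all _ fun z => mul_nonneg (Real.exp_pos _).le ?_
    linarith [Real.cos_le_one (2 * Real.pi * inner ℝ d z)]

/-- The Riesz potential kernel as a superposition of heat kernels. -/
noncomputable def riesz (α : ℝ) (v : E n) : ℝ≥0∞ :=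
  ∫⁻ t, powKernel α t * ENNReal.ofReal (heat t v)

@[fun_prop]
lemma measurable_riesz (α : ℝ) : Measurable (riesz α : E n → ℝ≥0∞) := by
  exact Measurable.lintegral_prod_left' (f := fun q : ℝ × E n =>
    powKernel α q.1 * ENNReal.ofReal (heat q.1 q.2)) (by fun_prop)

lemma riesz_neg (α : ℝ) (v : E n) : riesz α (-v) = riesz α v := by simp [riesz, heat_neg]

lemma riesz_eq {α : ℝ} (hα : α < n / 2) {v : E n} (hv : v ≠ 0) :
    riesz α v = ENNReal.ofReal
      (Real.Gamma (n / 2 - α) * (Real.pi * ‖v‖ ^ 2) ^ (α - n / 2)) := by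
  have h := lintegral_rpow_mul_exp_neg_div (a := n / 2 - α) (r := Real.pi * ‖v‖ ^ 2)
    (by linarith) (by positivity)
  rw [neg_sub] at h
  rw [riesz, lintegral_powKernel_mul, mul_comm (Real.Gamma _), ← h]
  refine setLIntegral_congr_fun measurableSet_Ioi fun t ht => ?_
  have ht : (0 : ℝ) < t := ht
  rw [← ENNReal.ofReal_mul (by positivity), heat, ← mul_assoc, ← Real.rpow_add ht]
  congr 3; ring

/-- The composition law of Riesz potentials. -/
lemma lintegral_riesz_mul_riesz {α β : ℝ} (hα : 0 < α) (hβ : 0 < β) (v : E n) :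
    ∫⁻ z, riesz α z * riesz β (v + z) =
      ENNReal.ofReal (Real.Gamma α * Real.Gamma β / Real.Gamma (α + β)) * riesz (α + β) v := by
  -- Both potentials are expanded in heat kernels; the `z`-integral is then the heat semigroup law,
  -- and the double integral in time is Euler's beta integral.
  have h1 : ∀ z, riesz α z * riesz β (v + z) =
      ∫⁻ t, ∫⁻ u, powKernel α t * powKernel β u *
        (ENNReal.ofReal (heat t z) * ENNReal.ofReal (heat u (v + z))) := by
    intro z
    rw [riesz, riesz, ← lintegral_lintegral_mul
      (by fun_prop) (by fun_prop)]
    refine lintegral_congr fun t => lintegral_congr fun u => by ring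
  simp only [h1]
  rw [lintegral_lintegral_swap]
  swap
  · refine (Measurable.lintegral_prod_right' (f := fun q : (E n × ℝ) × ℝ =>
      powKernel α q.1.2 * powKernel β q.2 * (ENNReal.ofReal (heat q.1.2 q.1.1) *
        ENNReal.ofReal (heat q.2 (v + q.1.1)))) ?_).aemeasurable
    fun_prop
  have h2 : ∀ t, ∫⁻ z : E n, ∫⁻ u, powKernel α t * powKernel β u *
        (ENNReal.ofReal (heat t z) * ENNReal.ofReal (heat u (v + z))) =
      ∫⁻ u, powKernel α t * powKernel β u * ENNReal.ofReal (heat (t + u) v) := by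
    intro t
    rw [lintegral_lintegral_swap (by fun_prop)]
    refine lintegral_congr fun u => ?_
    rw [lintegral_const_mul _ (by fun_prop)]
    by_cases ht : 0 < t
    · by_cases hu : 0 < u
      · rw [lintegral_heat_mul_heat ht hu]
      · simp [powKernel, indicator, hu]
    · simp [powKernel, indicator, ht]
  simp only [h2]
  exact lintegral_powKernel_powKernel hα hβ
    (Φ := fun r => ENNReal.ofReal (heat r v)) (by fun_prop)

/-! ### The Fourier transform of Schwartz functions on `ℝⁿ × ℝⁿ` -/

instance : (volume : Measure (E n × E n)).IsAddHaarMeasure :=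
  Measure.prod.instIsAddHaarMeasure _ _

/-- The Euclidean pairing on `ℝⁿ × ℝⁿ`. -/
noncomputable def dot (z w : E n × E n) : ℝ := inner ℝ z.1 w.1 + inner ℝ z.2 w.2

/-- The character `exp(2πi z·w)`. -/
noncomputable def char (z w : E n × E n) : ℂ :=
  Complex.exp (2 * Real.pi * Complex.I * (dot z w : ℂ))

lemma dot_comm (z w : E n × E n) : dot z w = dot w z := by
  simp only [dot, real_inner_comm]

lemma dot_add (z w w' : E n × E n) : dot z (w + w') = dot z w + dot z w' := by
  simp only [dot, Prod.fst_add, Prod.snd_add, inner_add_right]; ring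

lemma dot_neg (z w : E n × E n) : dot z (-w) = -dot z w := by
  simp only [dot, Prod.fst_neg, Prod.snd_neg, inner_neg_right]; ring

lemma char_comm (z w : E n × E n) : char z w = char w z := by rw [char, char, dot_comm]

lemma char_add (z w w' : E n × E n) : char z (w + w') = char z w * char z w' := by
  rw [char, char, char, dot_add, ← Complex.exp_add]; push_cast; ring_nf

lemma norm_char (z w : E n × E n) : ‖char z w‖ = 1 := by
  rw [char, show 2 * Real.pi * Complex.I * (dot z w : ℂ) =
    ((2 * Real.pi * dot z w : ℝ) : ℂ) * Complex.I by push_cast; ring,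
    Complex.norm_exp_ofReal_mul_I]

lemma conj_char (z w : E n × E n) : conj (char z w) = char z (-w) := by
  rw [char, char, ← Complex.exp_conj, dot_neg]
  simp [Complex.conj_ofNat]

@[fun_prop]
lemma continuous_char {γ : Type*} [TopologicalSpace γ] {f g : γ → E n × E n}
    (hf : Continuous f) (hg : Continuous g) : Continuous fun x => char (f x) (g x) := by
  unfold char dot; fun_prop

lemma fourier_eq (a : E n × E n → ℂ) (w : E n × E n) :
    fourier a w = ∫ z, char z w * a z := rfl

lemma fourier_modulate (a : E n × E n → ℂ) (h w : E n × E n) :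
    fourier (fun z => char z h * a z) w = fourier a (w + h) := by
  simp only [fourier_eq, char_add, mul_assoc]

lemma fourier_translate (a : E n × E n → ℂ) (h w : E n × E n) :
    fourier (fun z => a (z + h)) w = char w (-h) * fourier a w := by
  rw [fourier_eq, fourier_eq, ← integral_const_mul,
    ← integral_add_right_eq_self (fun z => char w (-h) * (char z w * a z)) h]
  refine integral_congr_ae (ae_of_all _ fun z => ?_)
  simp only
  rw [← mul_assoc, char_comm (z + h) w, ← char_add, char_comm z w]
  congr 2; abel

/-- The Fourier transform as a Schwartz function on `ℝⁿ × ℝⁿ`. -/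
noncomputable def hat (f : 𝓢(E n × E n, ℂ)) : 𝓢(E n × E n, ℂ) :=
  SchwartzMap.compCLMOfContinuousLinearEquiv ℝ
    (WithLp.prodContinuousLinearEquiv 2 ℝ (E n) (E n)).symm
    (𝓕⁻ (SchwartzMap.compCLMOfContinuousLinearEquiv ℝ
      (WithLp.prodContinuousLinearEquiv 2 ℝ (E n) (E n)) f))

lemma integral_withLp (g : E n × E n → ℂ) :
    ∫ v : WithLp 2 (E n × E n), g (WithLp.ofLp v) = ∫ z, g z :=
  (WithLp.volume_preserving_ofLp (E n) (E n)).integral_comp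
    (MeasurableEquiv.toLp 2 (E n × E n)).symm.measurableEmbedding g

/-- The phase `+2πi` is why `hat` is built from `𝓕⁻`; the detour through `WithLp 2` is needed
because the plain product carries the sup norm and no inner product. -/
lemma hat_eq_fourier (f : 𝓢(E n × E n, ℂ)) (w : E n × E n) : hat f w = fourier f w := by
  rw [fourier_eq, ← integral_withLp]
  simp only [hat, SchwartzMap.compCLMOfContinuousLinearEquiv_apply, Function.comp_apply,
    SchwartzMap.fourierInv_coe, Real.fourierInv_eq']
  refine integral_congr_ae (ae_of_all _ fun z => ?_)
  refine congrArg₂ (· * ·) (congrArg Complex.exp ?_) rfl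
  simp [dot]
  ring

lemma fourier_inversion (f : 𝓢(E n × E n, ℂ)) (z : E n × E n) :
    f z = ∫ w, char z (-w) * hat f w := by
  set F := SchwartzMap.compCLMOfContinuousLinearEquiv ℝ
      (WithLp.prodContinuousLinearEquiv 2 ℝ (E n) (E n)) f with hF
  have h : 𝓕 (𝓕⁻ F) (WithLp.toLp 2 z) = f z := by
    rw [FourierTransform.fourier_fourierInv_eq]
    rfl
  rw [← h, ← integral_withLp]
  simp only [SchwartzMap.fourier_coe, Real.fourier_eq']
  refine integral_congr_ae (ae_of_all _ fun w => ?_)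
  refine congrArg₂ (· * ·) (congrArg Complex.exp ?_) rfl
  simp [dot, real_inner_comm]
  ring

/-- Parseval's identity, one of the two functions being only integrable. -/
lemma integral_mul_conj_eq {a : E n × E n → ℂ} (ha : Integrable a) (f : 𝓢(E n × E n, ℂ)) :
    ∫ z, a z * conj (f z) = ∫ w, fourier a w * conj (fourier f w) := by
  -- Inversion is applied to `f` alone, so Fubini only asks for `a` and `hat f` to be integrable.
  have h1 : ∀ z, a z * conj (f z) = ∫ w, a z * conj (hat f w) * char z w := by
    intro z
    rw [fourier_inversion f z, ← integral_conj, ← integral_const_mul]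
    refine integral_congr_ae (ae_of_all _ fun w => ?_)
    simp only [map_mul, conj_char, neg_neg]; ring
  have h2 : ∀ w, fourier a w * conj (fourier f w) = ∫ z, a z * conj (hat f w) * char z w := by
    intro w
    rw [fourier_eq a, ← integral_mul_const, ← hat_eq_fourier]
    refine integral_congr_ae (ae_of_all _ fun z => ?_)
    simp only; ring
  simp only [h1, h2]
  refine integral_integral_swap ?_
  have hf : Integrable fun w => conj (hat f w) := (Complex.conjLIE.integrable_comp_iff).2 (hat f).integrable
  refine (ha.mul_prod hf).mul_bdd (c := 1) (by fun_prop) (ae_of_all _ fun q => ?_)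
  rw [norm_char]

lemma integrable_norm_sq (f : 𝓢(E n × E n, ℂ)) : Integrable fun z => ‖f z‖ ^ 2 :=
  (memLp_two_iff_integrable_sq_norm f.continuous.aestronglyMeasurable).1 (f.memLp 2)

lemma integral_norm_sq_fourier (f : 𝓢(E n × E n, ℂ)) :
    ∫ w, ‖fourier f w‖ ^ 2 = ∫ z, ‖f z‖ ^ 2 := by
  have h := integral_mul_conj_eq f.integrable f
  simp only [Complex.mul_conj, Complex.normSq_eq_norm_sq] at h
  have h1 : ((∫ z, ‖f z‖ ^ 2 : ℝ) : ℂ) = ((∫ w, ‖fourier f w‖ ^ 2 : ℝ) : ℂ) := by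
    rw [← integral_complex_ofReal, ← integral_complex_ofReal]; exact h
  exact_mod_cast h1.symm

lemma re_char (z w : E n × E n) : (char z w).re = Real.cos (2 * Real.pi * dot z w) := by
  rw [char, show 2 * Real.pi * Complex.I * (dot z w : ℂ) =
    ((2 * Real.pi * dot z w : ℝ) : ℂ) * Complex.I by push_cast; ring,
    Complex.exp_ofReal_mul_I_re]

lemma continuous_dot {γ : Type*} [TopologicalSpace γ] {f g : γ → E n × E n}
    (hf : Continuous f) (hg : Continuous g) : Continuous fun x => dot (f x) (g x) := by
  unfold dot; fun_prop

lemma integrable_norm_sq_hat_mul (f : 𝓢(E n × E n, ℂ)) (h : E n × E n) :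
    Integrable fun w => ‖hat f w‖ ^ 2 * Real.cos (2 * Real.pi * dot w h) :=
  (integrable_norm_sq (hat f)).mul_bdd (c := 1)
    (Continuous.aestronglyMeasurable (by have := @continuous_dot n; fun_prop))
    (ae_of_all _ fun _ => Real.abs_cos_le_one _)

lemma integrable_norm_sub_translate_sq (f : 𝓢(E n × E n, ℂ)) (h : E n × E n) :
    Integrable fun z => ‖f z - f (z + h)‖ ^ 2 := by
  have h2 : MemLp (fun z => f (z + h)) 2 :=
    (f.memLp 2).comp_measurePreserving (measurePreserving_add_right volume h)
  have h3 : MemLp (fun z => f z - f (z + h)) 2 := (f.memLp 2).sub h2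
  exact (memLp_two_iff_integrable_sq_norm h3.aestronglyMeasurable).1 h3

/-- Plancherel's identity for a difference of translates. -/
lemma integral_norm_sub_translate_sq (f : 𝓢(E n × E n, ℂ)) (h : E n × E n) :
    ∫ z, ‖f z - f (z + h)‖ ^ 2 =
      ∫ w, ‖hat f w‖ ^ 2 * (2 - 2 * Real.cos (2 * Real.pi * dot w h)) := by
  have i0 := integrable_norm_sq f
  have i1 : Integrable fun z => ‖f (z + h)‖ ^ 2 := i0.comp_add_right h
  have ia : Integrable fun z => f (z + h) := f.integrable.comp_add_right h
  have i2 : Integrable fun z => f (z + h) * conj (f z) := by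
    have h2 : MemLp (fun z => f (z + h)) 2 :=
      (f.memLp 2).comp_measurePreserving (measurePreserving_add_right volume h)
    have h3 : MemLp (fun z => conj (f z)) 2 := 
      (f.memLp 2).of_le (Continuous.aestronglyMeasurable (by fun_prop))
        (ae_of_all _ fun z => (RCLike.norm_conj (f z)).le)
    exact h2.integrable_mul h3
  have e0 : ∫ z, ‖f (z + h)‖ ^ 2 = ∫ z, ‖f z‖ ^ 2 :=
    integral_add_right_eq_self (fun z => ‖f z‖ ^ 2) h
  -- The cross term: Parseval against the translate of `f` produces a character, whose real part is
  -- the cosine.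
  have e1 : ∫ z, (f (z + h) * conj (f z)).re =
      ∫ w, ‖hat f w‖ ^ 2 * Real.cos (2 * Real.pi * dot w h) := by
    have h1 := congrArg Complex.re (integral_mul_conj_eq ia f)
    have h2 : ∀ w, fourier (fun z => f (z + h)) w * conj (fourier f w) =
        ((‖hat f w‖ ^ 2 : ℝ) : ℂ) * char w (-h) := by
      intro w
      rw [fourier_translate, hat_eq_fourier, mul_assoc, Complex.mul_conj,
        Complex.normSq_eq_norm_sq, mul_comm]
    simp only [h2] at h1
    have i3 : Integrable fun w => ((‖hat f w‖ ^ 2 : ℝ) : ℂ) * char w (-h) :=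
      (integrable_norm_sq (hat f)).ofReal.mul_bdd (c := 1)
        (Continuous.aestronglyMeasurable (by fun_prop)) (ae_of_all _ fun _ => (norm_char _ _).le)
    have h3 := integral_re i2
    have h4 := integral_re i3
    simp only [RCLike.re_to_complex] at h3 h4
    rw [h3, h1, ← h4]
    refine integral_congr_ae (ae_of_all _ fun w => ?_)
    simp only [Complex.re_ofReal_mul, re_char, dot_neg, mul_neg, Real.cos_neg]
  have e2 : ∀ z, ‖f z - f (z + h)‖ ^ 2 =
      ‖f z‖ ^ 2 + ‖f (z + h)‖ ^ 2 - 2 * (f (z + h) * conj (f z)).re := by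
    intro z
    rw [norm_sub_rev, ← Complex.normSq_eq_norm_sq, Complex.normSq_sub,
      Complex.normSq_eq_norm_sq, Complex.normSq_eq_norm_sq]
    ring
  have e3 : ∀ w, ‖hat f w‖ ^ 2 * (2 - 2 * Real.cos (2 * Real.pi * dot w h)) =
      2 * ‖hat f w‖ ^ 2 - 2 * (‖hat f w‖ ^ 2 * Real.cos (2 * Real.pi * dot w h)) :=
    fun w => by ring
  have e4 := integral_norm_sq_fourier f
  simp only [← hat_eq_fourier] at e4
  simp only [e2, e3]
  have i01 : Integrable fun z => ‖f z‖ ^ 2 + ‖f (z + h)‖ ^ 2 := i0.add i1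
  have i2' : Integrable fun z => 2 * (f (z + h) * conj (f z)).re := i2.re.const_mul 2
  rw [integral_sub i01 i2', integral_add i0 i1, integral_const_mul, e0,
    e1, integral_sub ((integrable_norm_sq (hat f)).const_mul 2)
    ((integrable_norm_sq_hat_mul f h).const_mul 2), integral_const_mul, integral_const_mul, e4]
  ring

/-! ### Pitt's inequality -/

/-- The antidiagonal vector `(ζ, -ζ)`. -/
def antidiag (ζ : E n) : E n × E n := (ζ, -ζ)

/-- Half the difference variable. -/
noncomputable def halfDiff (w : E n × E n) : E n := (2⁻¹ : ℝ) • (w.1 - w.2)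

@[fun_prop]
lemma continuous_antidiag : Continuous (antidiag : E n → E n × E n) := by
  unfold antidiag; fun_prop

@[fun_prop]
lemma continuous_halfDiff : Continuous (halfDiff : E n × E n → E n) := by
  unfold halfDiff; fun_prop

lemma antidiag_neg (ζ : E n) : antidiag (-ζ) = -antidiag ζ := rfl

/-- The factor one half makes antidiagonal translation by `ζ` act as translation by exactly `ζ`, so
that integration in `ζ` becomes a convolution on `ℝⁿ`. -/
lemma halfDiff_add_antidiag (w : E n × E n) (ζ : E n) :
    halfDiff (w + antidiag ζ) = halfDiff w + ζ := by
  simp only [halfDiff, antidiag, Prod.fst_add, Prod.snd_add]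
  rw [show w.1 + ζ - (w.2 + -ζ) = (w.1 - w.2) + (2 : ℝ) • ζ by rw [two_smul]; abel, smul_add,
    smul_smul]
  norm_num

lemma dot_antidiag (z : E n × E n) (ζ : E n) :
    dot z (antidiag ζ) = inner ℝ (z.1 - z.2) ζ := by
  simp only [dot, antidiag, inner_neg_right, inner_sub_left]; ring

lemma ae_fst_ne_snd (hn : 1 ≤ n) : ∀ᵐ w : E n × E n, w.1 ≠ w.2 := by
  have : Nonempty (Fin n) := ⟨⟨0, hn⟩⟩
  have hm : MeasurableSet {w : E n × E n | w.1 ≠ w.2} :=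
    (isClosed_eq continuous_fst continuous_snd).measurableSet.compl
  refine (Measure.ae_prod_iff_ae_ae hm).2 (ae_of_all _ fun x => ?_)
  filter_upwards [compl_mem_ae_iff.2 (measure_singleton x)] with y hy h
  exact hy h.symm

lemma halfDiff_ne_zero {w : E n × E n} (h : w.1 ≠ w.2) : halfDiff w ≠ 0 := by
  simp [halfDiff, sub_eq_zero, h]

lemma norm_halfDiff (w : E n × E n) : ‖halfDiff w‖ = 2⁻¹ * ‖w.1 - w.2‖ := by
  rw [halfDiff, norm_smul]; norm_num

lemma enorm_complex_ofReal (r : ℝ) : ‖(r : ℂ)‖ₑ = ‖r‖ₑ := by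
  rw [← ofReal_norm, Complex.norm_real, ofReal_norm]

/-- The Gaussian in `x - y` is the average of the characters at `antidiag ζ` against `heat t`. Each
character translates `hat f` by `antidiag ζ`, so Parseval gives an exact identity; the inequality is
only the passage to absolute values. -/
lemma lintegral_gaussian_norm_sq_le {t : ℝ} (ht : 0 < t) (f : 𝓢(E n × E n, ℂ)) :
    ∫⁻ z : E n × E n,
        ENNReal.ofReal (Real.exp (-(Real.pi * ‖z.1 - z.2‖ ^ 2 * t))) * ‖f z‖ₑ ^ 2 ≤
      ∫⁻ ζ : E n, ENNReal.ofReal (heat t ζ) * ∫⁻ w, ‖hat f (w + antidiag ζ)‖ₑ * ‖hat f w‖ₑ := by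
  have hi : Integrable fun z : E n × E n =>
      Real.exp (-(Real.pi * ‖z.1 - z.2‖ ^ 2 * t)) * ‖f z‖ ^ 2 := by
    refine (integrable_norm_sq f).bdd_mul (c := 1)
      (Continuous.aestronglyMeasurable (by fun_prop)) (ae_of_all _ fun z => ?_)
    rw [Real.norm_of_nonneg (Real.exp_pos _).le, Real.exp_le_one_iff]
    simp only [Left.neg_nonpos_iff]; positivity
  have hff : Integrable fun z => f z * conj (f z) := by
    refine (integrable_norm_sq f).ofReal.congr (ae_of_all _ fun z => ?_)
    simp only [Complex.mul_conj, Complex.normSq_eq_norm_sq]; rfl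
  have e1 : ((∫ z : E n × E n,
      Real.exp (-(Real.pi * ‖z.1 - z.2‖ ^ 2 * t)) * ‖f z‖ ^ 2 : ℝ) : ℂ) =
      ∫ ζ : E n, (heat t ζ : ℂ) * ∫ w, hat f (w + antidiag ζ) * conj (hat f w) := by
    rw [← integral_complex_ofReal]
    have e2 : ∀ z : E n × E n,
        ((Real.exp (-(Real.pi * ‖z.1 - z.2‖ ^ 2 * t)) * ‖f z‖ ^ 2 : ℝ) : ℂ) =
        ∫ ζ : E n, (heat t ζ : ℂ) * (f z * conj (f z)) * char z (antidiag ζ) := by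
      intro z
      have h := integral_heat_mul_cexp ht (z.1 - z.2)
      rw [Complex.ofReal_mul, Complex.ofReal_exp, Complex.ofReal_neg,
        show Real.pi * ‖z.1 - z.2‖ ^ 2 * t = Real.pi * t * ‖z.1 - z.2‖ ^ 2 by ring, ← h,
        ← integral_mul_const]
      refine integral_congr_ae (ae_of_all _ fun ζ => ?_)
      simp only [char, dot_antidiag, Complex.mul_conj, Complex.normSq_eq_norm_sq]
      ring
    have e3 : ∀ ζ : E n, (heat t ζ : ℂ) * ∫ w, hat f (w + antidiag ζ) * conj (hat f w) =
        ∫ z, (heat t ζ : ℂ) * (f z * conj (f z)) * char z (antidiag ζ) := by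
      intro ζ
      have ha : Integrable fun z => char z (antidiag ζ) * f z :=
        f.integrable.bdd_mul (c := 1) (Continuous.aestronglyMeasurable (by fun_prop))
          (ae_of_all _ fun z => (norm_char _ _).le)
      have h := integral_mul_conj_eq ha f
      simp only [fourier_modulate, ← hat_eq_fourier] at h
      rw [← h, ← integral_const_mul]
      refine integral_congr_ae (ae_of_all _ fun z => ?_)
      simp only; ring
    simp only [e2, e3]
    refine integral_integral_swap ?_
    have hq : Integrable (fun q : (E n × E n) × E n =>
        (f q.1 * conj (f q.1)) * ((heat t q.2 : ℝ) : ℂ)) (volume.prod volume) :=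
      hff.mul_prod (integrable_heat ht).ofReal
    refine (hq.mul_bdd (c := 1) (g := fun q => char q.1 (antidiag q.2))
      (Continuous.aestronglyMeasurable (by fun_prop))
      (ae_of_all _ fun q => (norm_char _ _).le)).congr (ae_of_all _ fun q => ?_)
    simp only [Function.uncurry]; ring
  have e4 : ∫⁻ z : E n × E n,
        ENNReal.ofReal (Real.exp (-(Real.pi * ‖z.1 - z.2‖ ^ 2 * t))) * ‖f z‖ₑ ^ 2 =
      ENNReal.ofReal (∫ z : E n × E n,
        Real.exp (-(Real.pi * ‖z.1 - z.2‖ ^ 2 * t)) * ‖f z‖ ^ 2) := by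
    rw [ofReal_integral_eq_lintegral_ofReal hi (ae_of_all _ fun z => by
      simp only [Pi.zero_apply]; positivity)]
    refine lintegral_congr fun z => ?_
    rw [ENNReal.ofReal_mul (Real.exp_pos _).le, ENNReal.ofReal_pow (norm_nonneg _),
      ofReal_norm]
  rw [e4, ← Real.enorm_of_nonneg (integral_nonneg fun z => by positivity), ← enorm_complex_ofReal, e1]
  refine (enorm_integral_le_lintegral_enorm _).trans (lintegral_mono fun ζ => ?_)
  rw [enorm_mul, enorm_complex_ofReal, Real.enorm_of_nonneg (heat_nonneg ht ζ)]
  gcongr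
  refine (enorm_integral_le_lintegral_enorm _).trans (lintegral_mono fun w => ?_)
  simp [enorm_mul]

lemma ofReal_rpow_neg_eq {lam r : ℝ} (hl : 0 < lam) (hr : 0 < r) :
    ENNReal.ofReal (r ^ (-lam)) = ENNReal.ofReal (Real.pi ^ (lam / 2) / Real.Gamma (lam / 2)) *
      ∫⁻ t, powKernel (lam / 2) t * ENNReal.ofReal (Real.exp (-(Real.pi * r ^ 2 * t))) := by
  have hΓ := Real.Gamma_pos_of_pos (half_pos hl)
  have h := lintegral_rpow_mul_exp_neg (a := lam / 2) (r := Real.pi * r ^ 2) (half_pos hl)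
    (by positivity)
  rw [lintegral_powKernel_mul]
  have h2 : ∫⁻ t in Ioi (0 : ℝ), ENNReal.ofReal (t ^ (lam / 2 - 1)) *
      ENNReal.ofReal (Real.exp (-(Real.pi * r ^ 2 * t))) =
      ENNReal.ofReal ((Real.pi * r ^ 2) ^ (-(lam / 2)) * Real.Gamma (lam / 2)) := by
    rw [← h]
    refine setLIntegral_congr_fun measurableSet_Ioi fun t ht => ?_
    have ht : (0 : ℝ) < t := ht
    rw [← ENNReal.ofReal_mul (by positivity)]
  rw [h2, ← ENNReal.ofReal_mul (by positivity)]
  congr 1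
  rw [Real.mul_rpow (by positivity) (by positivity), Real.rpow_neg Real.pi_pos.le,
    ← Real.rpow_natCast, ← Real.rpow_mul hr.le,
    show ((2 : ℕ) : ℝ) * -(lam / 2) = -lam by push_cast; ring]
  field_simp

/-- At `r = 0` the convention `0 ^ (-lam) = 0` destroys equality, the right side being infinite
there; the surviving bound holds at every point. -/
lemma ofReal_rpow_neg_le {lam r : ℝ} (hl : 0 < lam) (hr : 0 ≤ r) :
    ENNReal.ofReal (r ^ (-lam)) ≤ ENNReal.ofReal (Real.pi ^ (lam / 2) / Real.Gamma (lam / 2)) *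
      ∫⁻ t, powKernel (lam / 2) t * ENNReal.ofReal (Real.exp (-(Real.pi * r ^ 2 * t))) := by
  rcases hr.eq_or_lt with rfl | hr
  · rw [Real.zero_rpow (by linarith)]; simp
  · exact (ofReal_rpow_neg_eq hl hr).le

/-- The difference of the two sides is `(aA - bB)² / (AB)`. -/
lemma two_mul_mul_le_weighted {a b A B : ℝ≥0∞} (ha : a ≠ ⊤) (hb : b ≠ ⊤) (hA : A ≠ 0)
    (hA' : A ≠ ⊤) (hB : B ≠ 0) (hB' : B ≠ ⊤) :
    2 * (a * b) ≤ a ^ 2 * B⁻¹ * A + b ^ 2 * A⁻¹ * B := by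
  lift a to NNReal using ha
  lift b to NNReal using hb
  lift A to NNReal using hA'
  lift B to NNReal using hB'
  simp only [ne_eq, ENNReal.coe_eq_zero] at hA hB
  rw [← ENNReal.coe_inv hA, ← ENNReal.coe_inv hB]
  norm_cast
  rw [← NNReal.coe_le_coe]
  push_cast
  have hA0 : (0 : ℝ) < A := by positivity
  have hB0 : (0 : ℝ) < B := by positivity
  have : (a : ℝ) ^ 2 * (B : ℝ)⁻¹ * A + (b : ℝ) ^ 2 * (A : ℝ)⁻¹ * B - 2 * (a * b) =
      (a * A - b * B) ^ 2 / (A * B) := by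
    field_simp; ring
  have h2 : 0 ≤ ((a : ℝ) * A - b * B) ^ 2 / (A * B) := by positivity
  linarith

/-- Schur's test for the convolution with `k` in the antidiagonal direction, with weight `p`. -/
lemma lintegral_schur {k : E n → ℝ≥0∞} {p N : E n × E n → ℝ≥0∞} (hk : Measurable k)
    (hke : ∀ ζ, k (-ζ) = k ζ) (hp : Measurable p) (hN : Measurable N) (hNt : ∀ w, N w ≠ ⊤)
    (hp0 : ∀ᵐ w, p w ≠ 0 ∧ p w ≠ ⊤) :
    ∫⁻ ζ, k ζ * ∫⁻ w, N (w + antidiag ζ) * N w ≤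
      ∫⁻ w, N w ^ 2 * (p w)⁻¹ * ∫⁻ ζ, k ζ * p (w + antidiag ζ) := by
  have e1 : ∫⁻ w, N w ^ 2 * (p w)⁻¹ * ∫⁻ ζ, k ζ * p (w + antidiag ζ) =
      ∫⁻ ζ, k ζ * ∫⁻ w, N w ^ 2 * (p w)⁻¹ * p (w + antidiag ζ) := by
    have e2 : ∀ w, N w ^ 2 * (p w)⁻¹ * ∫⁻ ζ, k ζ * p (w + antidiag ζ) =
        ∫⁻ ζ, k ζ * (N w ^ 2 * (p w)⁻¹ * p (w + antidiag ζ)) := fun w => by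
      rw [← lintegral_const_mul _ (by fun_prop)]
      refine lintegral_congr fun ζ => by ring
    have e3 : ∀ ζ, k ζ * ∫⁻ w, N w ^ 2 * (p w)⁻¹ * p (w + antidiag ζ) =
        ∫⁻ w, k ζ * (N w ^ 2 * (p w)⁻¹ * p (w + antidiag ζ)) := fun ζ => by
      rw [← lintegral_const_mul _ (by fun_prop)]
    simp only [e2, e3]
    exact lintegral_lintegral_swap (by fun_prop)
  -- Evenness of `k` together with the translation `w ↦ w + antidiag ζ` exchanges the two halves of
  -- the weighted arithmetic-geometric bound.
  have e4 : ∫⁻ ζ, k ζ * ∫⁻ w, N (w + antidiag ζ) ^ 2 * (p (w + antidiag ζ))⁻¹ * p w =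
      ∫⁻ ζ, k ζ * ∫⁻ w, N w ^ 2 * (p w)⁻¹ * p (w + antidiag ζ) := by
    rw [← lintegral_neg_eq_self]
    refine lintegral_congr fun ζ => ?_
    rw [hke, ← lintegral_add_right_eq_self _ (antidiag ζ)]
    simp only [antidiag_neg, add_neg_cancel_right]
  have e5 : 2 * ∫⁻ ζ, k ζ * ∫⁻ w, N (w + antidiag ζ) * N w ≤
      (∫⁻ ζ, k ζ * ∫⁻ w, N (w + antidiag ζ) ^ 2 * (p (w + antidiag ζ))⁻¹ * p w) +
      ∫⁻ ζ, k ζ * ∫⁻ w, N w ^ 2 * (p w)⁻¹ * p (w + antidiag ζ) := by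
    have m1 : Measurable fun ζ : E n => ∫⁻ w, N (w + antidiag ζ) * N w :=
      Measurable.lintegral_prod_right' (f := fun q : E n × (E n × E n) =>
        N (q.2 + antidiag q.1) * N q.2) (by fun_prop)
    have m2 : Measurable fun ζ : E n =>
        ∫⁻ w, N (w + antidiag ζ) ^ 2 * (p (w + antidiag ζ))⁻¹ * p w :=
      Measurable.lintegral_prod_right' (f := fun q : E n × (E n × E n) =>
        N (q.2 + antidiag q.1) ^ 2 * (p (q.2 + antidiag q.1))⁻¹ * p q.2) (by fun_prop)
    rw [← lintegral_const_mul _ (by fun_prop), ← lintegral_add_left (by fun_prop)]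
    refine lintegral_mono fun ζ => ?_
    rw [← mul_add, mul_left_comm]
    gcongr
    rw [← lintegral_const_mul _ (by fun_prop), ← lintegral_add_left (by fun_prop)]
    refine lintegral_mono_ae ?_
    have hp1 : ∀ᵐ w, p (w + antidiag ζ) ≠ 0 ∧ p (w + antidiag ζ) ≠ ⊤ :=
      (measurePreserving_add_right volume (antidiag ζ)).quasiMeasurePreserving.ae hp0
    filter_upwards [hp0, hp1] with w h h'
    exact two_mul_mul_le_weighted (hNt _) (hNt _) h.1 h.2 h'.1 h'.2
  rw [e4, ← two_mul, ← e1] at e5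
  exact (ENNReal.mul_le_mul_iff_right two_ne_zero ofNat_ne_top).1 e5

lemma constF_pos {lam : ℝ} (hl : 0 < lam) (hln : lam < n) : 0 < constF n lam := by
  have h1 := Real.Gamma_pos_of_pos (show 0 < ((n : ℝ) - lam) / 4 by linarith)
  have h2 := Real.Gamma_pos_of_pos (show 0 < ((n : ℝ) + lam) / 4 by linarith)
  unfold constF; positivity

/-- Pitt's inequality in the difference variable, in `[0, ∞]`. -/
lemma lintegral_pitt (hn : 1 ≤ n) {lam : ℝ} (hl : 0 < lam) (hln : lam < n)
    (f : 𝓢(E n × E n, ℂ)) :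
    ∫⁻ z, ENNReal.ofReal (potentialDensity lam f z) ≤
      ENNReal.ofReal (constF n lam) * ∫⁻ w, ENNReal.ofReal (frequencyDensity lam f w) := by
  -- This `β` solves `n/2 - β = lam/2 + β`, so the Gamma quotient from the two Riesz kernels repeats
  -- the one from the composition law and yields the square in `constF`.
  set β : ℝ := (n - lam) / 4 with hβ
  have hβ0 : 0 < β := by rw [hβ]; linarith
  have hα0 : 0 < lam / 2 := by linarith
  have hαβ : lam / 2 + β = (n + lam) / 4 := by rw [hβ]; ring
  set c := ENNReal.ofReal (Real.pi ^ (lam / 2) / Real.Gamma (lam / 2)) with hc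
  set B := Real.Gamma (lam / 2) * Real.Gamma β / Real.Gamma (lam / 2 + β) with hB
  have hΓ1 := Real.Gamma_pos_of_pos hα0
  have hΓ2 := Real.Gamma_pos_of_pos hβ0
  have hΓ3 := Real.Gamma_pos_of_pos (add_pos hα0 hβ0)
  set N : E n × E n → ℝ≥0∞ := fun w => ‖hat f w‖ₑ with hN
  have mN : Measurable N := by fun_prop
  have mf : Measurable f := f.continuous.measurable
  calc ∫⁻ z, ENNReal.ofReal (potentialDensity lam f z)
      ≤ ∫⁻ z, c * ∫⁻ t, powKernel (lam / 2) t *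
          (ENNReal.ofReal (Real.exp (-(Real.pi * ‖z.1 - z.2‖ ^ 2 * t))) * ‖f z‖ₑ ^ 2) := by
        refine lintegral_mono fun z => ?_
        rw [potentialDensity, ENNReal.ofReal_mul (by positivity),
          ENNReal.ofReal_pow (norm_nonneg _), ofReal_norm]
        refine (mul_le_mul_left (ofReal_rpow_neg_le hl (norm_nonneg _)) _).trans_eq ?_
        rw [mul_assoc, ← lintegral_mul_const _ (by fun_prop)]
        simp only [mul_assoc]
        rfl
    _ = c * ∫⁻ t, powKernel (lam / 2) t * ∫⁻ z : E n × E n,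
          (ENNReal.ofReal (Real.exp (-(Real.pi * ‖z.1 - z.2‖ ^ 2 * t))) * ‖f z‖ₑ ^ 2) := by
        rw [lintegral_const_mul' _ _ ofReal_ne_top, lintegral_lintegral_swap (by fun_prop)]
        congr 1
        refine lintegral_congr fun t => ?_
        rw [lintegral_const_mul _ (by fun_prop)]
    _ ≤ c * ∫⁻ t, powKernel (lam / 2) t *
          ∫⁻ ζ : E n, ENNReal.ofReal (heat t ζ) * ∫⁻ w, N (w + antidiag ζ) * N w := by
        refine mul_le_mul_right (lintegral_mono fun t => ?_) c
        by_cases ht : 0 < t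
        · refine mul_le_mul_right ?_ _
          exact lintegral_gaussian_norm_sq_le ht f
        · simp [powKernel, indicator, ht]
    _ = c * ∫⁻ ζ : E n, riesz (lam / 2) ζ * ∫⁻ w, N (w + antidiag ζ) * N w := by
        have m1 : Measurable fun ζ : E n => ∫⁻ w, N (w + antidiag ζ) * N w :=
          Measurable.lintegral_prod_right' (f := fun q : E n × (E n × E n) =>
            N (q.2 + antidiag q.1) * N q.2) (by fun_prop)
        have e1 : ∀ t, powKernel (lam / 2) t *
            ∫⁻ ζ : E n, ENNReal.ofReal (heat t ζ) * ∫⁻ w, N (w + antidiag ζ) * N w =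
            ∫⁻ ζ : E n, powKernel (lam / 2) t *
              (ENNReal.ofReal (heat t ζ) * ∫⁻ w, N (w + antidiag ζ) * N w) := fun t => by
          rw [lintegral_const_mul _ (by fun_prop)]
        simp only [e1]
        rw [lintegral_lintegral_swap (by fun_prop)]
        congr 1
        refine lintegral_congr fun ζ => ?_
        rw [riesz, ← lintegral_mul_const _ (by fun_prop)]
        simp only [mul_assoc]
    _ ≤ c * ∫⁻ w, N w ^ 2 * (riesz β (halfDiff w))⁻¹ *
          ∫⁻ ζ, riesz (lam / 2) ζ * riesz β (halfDiff (w + antidiag ζ)) := by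
        gcongr
        refine lintegral_schur (p := fun w => riesz β (halfDiff w)) (by fun_prop)
          (riesz_neg _) (by fun_prop) mN (fun w => enorm_ne_top) ?_
        filter_upwards [ae_fst_ne_snd hn] with w hw
        have := norm_pos_iff.2 (halfDiff_ne_zero hw)
        have := Real.Gamma_pos_of_pos (show 0 < (n : ℝ) / 2 - β by rw [hβ]; linarith)
        rw [riesz_eq (by rw [hβ]; linarith) (halfDiff_ne_zero hw)]
        exact ⟨(ENNReal.ofReal_pos.2 (by positivity)).ne', ofReal_ne_top⟩
    _ = ∫⁻ w, c * (N w ^ 2 * (riesz β (halfDiff w))⁻¹ *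
          (ENNReal.ofReal B * riesz (lam / 2 + β) (halfDiff w))) := by
        rw [lintegral_const_mul' _ _ ofReal_ne_top]
        simp only [halfDiff_add_antidiag]
        simp only [lintegral_riesz_mul_riesz hα0 hβ0]
        rfl
    _ = ∫⁻ w, ENNReal.ofReal (constF n lam) * ENNReal.ofReal (frequencyDensity lam f w) := by
        refine lintegral_congr_ae ?_
        filter_upwards [ae_fst_ne_snd hn] with w hw
        have hw' := norm_pos_iff.2 (halfDiff_ne_zero hw)
        have hd : 0 < ‖w.1 - w.2‖ := norm_pos_iff.2 (sub_ne_zero.2 hw)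
        have hΓ4 := Real.Gamma_pos_of_pos (show 0 < (n : ℝ) / 2 - β by rw [hβ]; linarith)
        have hΓ5 := Real.Gamma_pos_of_pos (show 0 < (n : ℝ) / 2 - (lam / 2 + β) by
          rw [hαβ]; linarith)
        rw [riesz_eq (by rw [hβ]; linarith) (halfDiff_ne_zero hw),
          riesz_eq (by rw [hαβ]; linarith) (halfDiff_ne_zero hw),
          ← ENNReal.ofReal_inv_of_pos (by positivity), frequencyDensity, ← hat_eq_fourier,
          show N w = ENNReal.ofReal ‖hat f w‖ from (ofReal_norm _).symm, ← ENNReal.ofReal_pow (norm_nonneg _),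
          ← ENNReal.ofReal_mul (by positivity), ← ENNReal.ofReal_mul (by positivity),
          ← ENNReal.ofReal_mul (by positivity), ← ENNReal.ofReal_mul (by positivity),
          ← ENNReal.ofReal_mul (constF_pos hl hln).le]
        congr 1
        -- The weight cancels. The halving leaves `2^(-lam)`, and `π^(lam/2)` joins the equal power
        -- in `c` to form `(π/2)^lam`.
        have e1 : (Real.pi * ‖halfDiff w‖ ^ 2) ^ (lam / 2 + β - n / 2) =
            (Real.pi * ‖halfDiff w‖ ^ 2) ^ (β - n / 2) *
              (Real.pi ^ (lam / 2) * ((2 ^ lam)⁻¹ * ‖w.1 - w.2‖ ^ lam)) := by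
          rw [show lam / 2 + β - n / 2 = (β - n / 2) + lam / 2 by ring,
            Real.rpow_add (by positivity)]
          congr 1
          rw [Real.mul_rpow (by positivity) (by positivity), ← Real.rpow_natCast,
            ← Real.rpow_mul hw'.le, norm_halfDiff,
            show ((2 : ℕ) : ℝ) * (lam / 2) = lam by push_cast; ring,
            Real.mul_rpow (by positivity) hd.le, Real.inv_rpow (by positivity)]
        have e2 : (Real.pi : ℝ) ^ lam = Real.pi ^ (lam / 2) * Real.pi ^ (lam / 2) := by
          rw [← Real.rpow_add Real.pi_pos]; congr 1; ring
        have e3 : (n : ℝ) / 2 - (lam / 2 + β) = β := by rw [hβ]; ring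
        have e4 : (n : ℝ) / 2 - β = lam / 2 + β := by rw [hβ]; ring
        rw [e1, e3, e4, constF, ← hβ, ← hαβ, hB, Real.div_rpow Real.pi_pos.le (by positivity), e2]
        field_simp
    _ = _ := lintegral_const_mul' _ _ ofReal_ne_top

/-- One factor `‖g w‖` is bounded by a constant; the decay of the other absorbs the growth of the
power, after rounding `s` up to an integer. -/
lemma integrable_rpow_mul_norm_sq {s : ℝ} (hs : 0 ≤ s) (g : 𝓢(E n × E n, ℂ)) :
    Integrable fun w : E n × E n => ‖w.1 - w.2‖ ^ s * ‖g w‖ ^ 2 := by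
  obtain ⟨C, -, hC⟩ := g.decay 0 0
  simp only [pow_zero, one_mul, norm_iteratedFDeriv_zero] at hC
  set k := ⌈s⌉₊
  have hi : Integrable fun w : E n × E n => C * ‖g w‖ + C * 2 ^ k * (‖w‖ ^ k * ‖g w‖) :=
    (g.integrable.norm.const_mul C).add ((g.integrable_pow_mul volume k).const_mul (C * 2 ^ k))
  refine hi.mono' (Measurable.aestronglyMeasurable
    (by have := g.continuous.measurable; fun_prop)) (ae_of_all _ fun w => ?_)
  rw [Real.norm_of_nonneg (by positivity)]
  have h1 : ‖w.1 - w.2‖ ≤ 2 * ‖w‖ := by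
    linarith [norm_sub_le w.1 w.2, norm_fst_le w, norm_snd_le w]
  have h2 : ‖w.1 - w.2‖ ^ s ≤ 1 + 2 ^ k * ‖w‖ ^ k := by
    rw [← mul_pow]
    rcases le_total ‖w.1 - w.2‖ 1 with h | h
    · exact (Real.rpow_le_one (norm_nonneg _) h hs).trans (by simp)
    · calc ‖w.1 - w.2‖ ^ s ≤ ‖w.1 - w.2‖ ^ (k : ℝ) :=
            Real.rpow_le_rpow_of_exponent_le h (Nat.le_ceil s)
        _ = ‖w.1 - w.2‖ ^ k := Real.rpow_natCast _ _
        _ ≤ (2 * ‖w‖) ^ k := by gcongr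
        _ ≤ _ := by linarith
  calc ‖w.1 - w.2‖ ^ s * ‖g w‖ ^ 2 ≤ (1 + 2 ^ k * ‖w‖ ^ k) * (C * ‖g w‖) := by
        rw [sq]
        gcongr
        exact hC w
    _ = _ := by ring

lemma frequencyDensity_eq (lam : ℝ) (f : 𝓢(E n × E n, ℂ)) :
    frequencyDensity lam f = fun w => ‖w.1 - w.2‖ ^ lam * ‖hat f w‖ ^ 2 := by
  funext w; rw [frequencyDensity, hat_eq_fourier]

lemma integrable_frequencyDensity {lam : ℝ} (hl : 0 ≤ lam) (f : 𝓢(E n × E n, ℂ)) :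
    Integrable (frequencyDensity lam f) := by
  rw [frequencyDensity_eq]
  exact integrable_rpow_mul_norm_sq hl _

lemma potentialDensity_nonneg (lam : ℝ) (f : E n × E n → ℂ) (z : E n × E n) :
    0 ≤ potentialDensity lam f z := by
  unfold potentialDensity; positivity

lemma frequencyDensity_nonneg (lam : ℝ) (f : E n × E n → ℂ) (z : E n × E n) :
    0 ≤ frequencyDensity lam f z := by
  unfold frequencyDensity; positivity

lemma lintegral_frequencyDensity {lam : ℝ} (hl : 0 ≤ lam) (f : 𝓢(E n × E n, ℂ)) :
    ∫⁻ w, ENNReal.ofReal (frequencyDensity lam f w) =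
      ENNReal.ofReal (∫ w, frequencyDensity lam f w) :=
  (ofReal_integral_eq_lintegral_ofReal (integrable_frequencyDensity hl f)
    (ae_of_all _ (frequencyDensity_nonneg lam f))).symm

/-- Finiteness is read off from Pitt's inequality in `[0, ∞]`, with no separate estimate near the
diagonal. -/
lemma integrable_potentialDensity (hn : 1 ≤ n) {lam : ℝ} (hl : 0 < lam) (hln : lam < n)
    (f : 𝓢(E n × E n, ℂ)) : Integrable (potentialDensity lam f) := by
  refine ⟨Measurable.aestronglyMeasurable ?_, ?_⟩
  · have := f.continuous.measurable
    unfold potentialDensity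
    fun_prop
  · rw [hasFiniteIntegral_iff_ofReal (ae_of_all _ (potentialDensity_nonneg lam f))]
    refine (lintegral_pitt hn hl hln f).trans_lt ?_
    rw [lintegral_frequencyDensity hl.le]
    exact ENNReal.mul_lt_top ofReal_lt_top ofReal_lt_top

/-- Pitt's inequality in the difference variable. -/
theorem integral_pitt (hn : 1 ≤ n) {lam : ℝ} (hl : 0 < lam) (hln : lam < n)
    (f : 𝓢(E n × E n, ℂ)) :
    ∫ z, potentialDensity lam f z ≤ constF n lam * ∫ w, frequencyDensity lam f w := by
  have h := lintegral_pitt hn hl hln f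
  have h0 : 0 ≤ ∫ w, frequencyDensity lam f w :=
    integral_nonneg (frequencyDensity_nonneg lam f)
  rw [lintegral_frequencyDensity hl.le, ← ENNReal.ofReal_mul (constF_pos hl hln).le,
    ← ofReal_integral_eq_lintegral_ofReal (integrable_potentialDensity hn hl hln f)
    (ae_of_all _ (potentialDensity_nonneg lam f)),
    ENNReal.ofReal_le_ofReal_iff (mul_nonneg (constF_pos hl hln).le h0)] at h
  exact h

/-! ### The logarithmic uncertainty inequality -/

/-- A majorant uniform in `s`: both `r ^ s` and `|log r| / 4` are at most `r^(1/4) + r^(-1/4)`,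
whose square is at most twice the sum of squares. The final exponents `±1/2` stay above `-n`. -/
lemma abs_log_mul_rpow_le {r s : ℝ} (hr : 0 < r) (hs : |s| < 1 / 4) :
    |Real.log r * r ^ s| ≤ 8 * (r ^ (1 / 2 : ℝ) + r ^ (-(1 / 2) : ℝ)) := by
  rw [abs_lt] at hs
  have hr' := inv_pos.2 hr
  set a := r ^ (1 / 4 : ℝ) with ha
  set b := r ^ (-(1 / 4) : ℝ) with hb
  have ha0 : 0 < a := by positivity
  have hb0 : 0 < b := by positivity
  have h1 : Real.log r ≤ 4 * a := by
    have := Real.log_le_rpow_div hr.le (ε := 1 / 4) (by norm_num)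
    linarith
  have h2 : -Real.log r ≤ 4 * b := by
    have := Real.log_le_rpow_div hr'.le (ε := 1 / 4) (by norm_num)
    rw [Real.log_inv, Real.inv_rpow hr.le, ← Real.rpow_neg hr.le] at this
    linarith
  have h3 : |Real.log r| ≤ 4 * (a + b) := abs_le.2 ⟨by linarith, by linarith⟩
  have h4 : r ^ s ≤ a + b := by
    rcases le_total r 1 with h | h
    · have := Real.rpow_le_rpow_of_exponent_ge hr h hs.1.le
      linarith
    · have := Real.rpow_le_rpow_of_exponent_le h hs.2.le
      linarith
  have h5 : r ^ (1 / 2 : ℝ) = a * a := by rw [ha, ← Real.rpow_add hr]; norm_num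
  have h6 : r ^ (-(1 / 2) : ℝ) = b * b := by rw [hb, ← Real.rpow_add hr]; norm_num
  rw [abs_mul, abs_of_pos (Real.rpow_pos_of_pos hr s), h5, h6]
  calc _ ≤ 4 * (a + b) * (a + b) := by gcongr
    _ ≤ _ := by nlinarith [sq_nonneg (a - b)]

lemma hasDerivAt_integral_rpow (hn : 1 ≤ n) (g : 𝓢(E n × E n, ℂ)) :
    Integrable (fun w : E n × E n => Real.log ‖w.1 - w.2‖ * ‖g w‖ ^ 2) ∧
    HasDerivAt (fun s : ℝ => ∫ w : E n × E n, ‖w.1 - w.2‖ ^ s * ‖g w‖ ^ 2)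
      (∫ w : E n × E n, Real.log ‖w.1 - w.2‖ * ‖g w‖ ^ 2) 0 := by
  have mg := g.continuous.measurable
  have hn' : (1 : ℝ) ≤ n := by exact_mod_cast hn
  -- The negative power is covered by Pitt's inequality with exponent `1/2 < 1 ≤ n`.
  have hb : Integrable fun w : E n × E n => 8 * (‖w.1 - w.2‖ ^ (1 / 2 : ℝ) * ‖g w‖ ^ 2 +
      ‖w.1 - w.2‖ ^ (-(1 / 2) : ℝ) * ‖g w‖ ^ 2) :=
    ((integrable_rpow_mul_norm_sq (by norm_num) g).add
      (integrable_potentialDensity hn (by norm_num) (by linarith) g)).const_mul 8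
  have h := hasDerivAt_integral_of_dominated_loc_of_deriv_le (μ := volume) (x₀ := (0 : ℝ))
    (s := Metric.ball 0 (1 / 4)) (F := fun s (w : E n × E n) => ‖w.1 - w.2‖ ^ s * ‖g w‖ ^ 2)
    (F' := fun s w => Real.log ‖w.1 - w.2‖ * ‖w.1 - w.2‖ ^ s * ‖g w‖ ^ 2)
    (Metric.ball_mem_nhds _ (by norm_num))
    (Filter.Eventually.of_forall fun s => Measurable.aestronglyMeasurable (by fun_prop))
    (integrable_rpow_mul_norm_sq le_rfl g) (Measurable.aestronglyMeasurable (by fun_prop))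
    ?_ hb ?_
  · simpa only [Real.rpow_zero, mul_one] using h
  · filter_upwards [ae_fst_ne_snd hn] with w hw s hs
    have hr : 0 < ‖w.1 - w.2‖ := norm_pos_iff.2 (sub_ne_zero.2 hw)
    rw [norm_mul, Real.norm_eq_abs, Real.norm_of_nonneg (by positivity), ← add_mul, ← mul_assoc]
    gcongr
    exact abs_log_mul_rpow_le hr (by simpa using hs)
  · filter_upwards [ae_fst_ne_snd hn] with w hw s hs
    have hr : 0 < ‖w.1 - w.2‖ := norm_pos_iff.2 (sub_ne_zero.2 hw)
    have := ((hasDerivAt_id s).const_rpow hr).mul_const (‖g w‖ ^ 2)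
    simpa using this

/-- Since `constF n 0 = 1`, this is a logarithmic derivative: numerator and denominator each
contribute `-ψ(n/4)/4`, and the square doubles them to `-ψ(n/4)/2` each. -/
lemma hasDerivAt_constF (hn : 1 ≤ n) :
    HasDerivAt (constF n) (Real.log (Real.pi / 2) - psi ((n : ℝ) / 4)) 0 := by
  have hn' : (1 : ℝ) ≤ n := by exact_mod_cast hn
  have hp : 0 < (n : ℝ) / 4 := by linarith
  have hΓ := Real.Gamma_pos_of_pos hp
  have hd : HasDerivAt Real.Gamma (deriv Real.Gamma ((n : ℝ) / 4)) ((n : ℝ) / 4) :=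
    (Real.differentiableAt_Gamma fun m => by
      have : (0 : ℝ) ≤ m := m.cast_nonneg
      linarith).hasDerivAt
  set G' := deriv Real.Gamma ((n : ℝ) / 4)
  have hpsi : psi ((n : ℝ) / 4) = G' / Real.Gamma ((n : ℝ) / 4) := (hd.log hΓ.ne').deriv
  have h1 : HasDerivAt (fun s : ℝ => Real.Gamma ((n - s) / 4)) (G' * (-1 / 4)) 0 := by
    refine HasDerivAt.comp (0 : ℝ) (h₂ := Real.Gamma) (h := fun s : ℝ => ((n : ℝ) - s) / 4)
      (by simpa using hd) ?_
    simpa using ((hasDerivAt_id (0 : ℝ)).const_sub (n : ℝ)).div_const 4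
  have h2 : HasDerivAt (fun s : ℝ => Real.Gamma ((n + s) / 4)) (G' * (1 / 4)) 0 := by
    refine HasDerivAt.comp (0 : ℝ) (h₂ := Real.Gamma) (h := fun s : ℝ => ((n : ℝ) + s) / 4)
      (by simpa using hd) ?_
    simpa using ((hasDerivAt_id (0 : ℝ)).const_add (n : ℝ)).div_const 4
  have h3 := (h1.div h2 (by simpa using hΓ.ne')).pow 2
  have h4 := ((hasDerivAt_id (0 : ℝ)).const_rpow (show 0 < Real.pi / 2 by positivity)).mul h3
  refine (h4.congr_deriv ?_).congr_of_eventuallyEq (Filter.Eventually.of_forall fun s => rfl)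
  rw [hpsi]
  simp
  field_simp
  ring

lemma constF_zero (hn : 1 ≤ n) : constF n 0 = 1 := by
  have hn' : (1 : ℝ) ≤ n := by exact_mod_cast hn
  have hΓ := Real.Gamma_pos_of_pos (show 0 < (n : ℝ) / 4 by linarith)
  simp [constF, div_self hΓ.ne']

lemma nonneg_of_hasDerivAt_zero {φ : ℝ → ℝ} {d : ℝ} (h : HasDerivAt φ d 0) (h0 : φ 0 = 0)
    (hp : ∀ᶠ s in nhdsWithin 0 (Ioi 0), 0 ≤ φ s) : 0 ≤ d := by
  refine ge_of_tendsto h.tendsto_slope_zero_right ?_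
  filter_upwards [hp, self_mem_nhdsWithin] with s hs hs0
  have hs0 : (0 : ℝ) < s := hs0
  simp only [zero_add, h0, sub_zero, smul_eq_mul]
  positivity

/-- The logarithmic uncertainty inequality in the difference variable. -/
theorem log_uncertainty (hn : 1 ≤ n) (f : 𝓢(E n × E n, ℂ)) :
    (psi ((n : ℝ) / 4) - Real.log (Real.pi / 2)) * ∫ z, ‖f z‖ ^ 2 ≤
      (∫ z : E n × E n, Real.log ‖z.1 - z.2‖ * ‖f z‖ ^ 2) +
        ∫ w : E n × E n, Real.log ‖w.1 - w.2‖ * ‖fourier f w‖ ^ 2 := by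
  have hn' : (1 : ℝ) ≤ n := by exact_mod_cast hn
  have hf := (hasDerivAt_integral_rpow hn f).2
  have hF := (hasDerivAt_integral_rpow hn (hat f)).2
  have hf' : HasDerivAt (fun s : ℝ => ∫ w : E n × E n, ‖w.1 - w.2‖ ^ (-s) * ‖f w‖ ^ 2)
      ((∫ w : E n × E n, Real.log ‖w.1 - w.2‖ * ‖f w‖ ^ 2) * -1) 0 :=
    HasDerivAt.comp (0 : ℝ) (h₂ := fun s : ℝ => ∫ w : E n × E n, ‖w.1 - w.2‖ ^ s * ‖f w‖ ^ 2)
      (h := fun s : ℝ => -s) (by simpa using hf) (hasDerivAt_neg 0)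
  -- The right side minus the left side of Pitt's inequality, as a function of the exponent: zero at
  -- `0` by Plancherel, nonnegative on `(0, n)`.
  have hφ := ((hasDerivAt_constF hn).mul hF).sub hf'
  have e := integral_norm_sq_fourier f
  simp only [← hat_eq_fourier] at e ⊢
  have h := nonneg_of_hasDerivAt_zero hφ (by simp [constF_zero hn, e]) ?_
  · simp only [Real.rpow_zero, one_mul, constF_zero hn, e] at h
    linarith
  · filter_upwards [Ioo_mem_nhdsGT (show (0 : ℝ) < n by linarith)] with s hs
    have := integral_pitt hn hs.1 hs.2 f
    rw [frequencyDensity_eq] at this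
    exact sub_nonneg.2 this

/-! ### The nonlocal difference functional -/

/-- Expanding `|s|^(-n-lam)` in Gaussians reduces this to `lintegral_rpow_mul_one_sub_exp` with `a =
lam/2`. The condition `lam < 2` reflects the second-order vanishing of `2 - 2 cos` at the origin. -/
lemma lintegral_norm_rpow_mul_one_sub_cos (hn : 1 ≤ n) {lam : ℝ} (hl : 0 < lam) (hl2 : lam < 2)
    {d : E n} (hd : d ≠ 0) :
    ∫⁻ s : E n, ENNReal.ofReal (‖s‖ ^ (-(n : ℝ) - lam)) *
        ENNReal.ofReal (2 - 2 * Real.cos (2 * Real.pi * inner ℝ d s)) =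
      ENNReal.ofReal (4 / lam * Real.pi ^ ((n : ℝ) / 2 + lam) * Real.Gamma (1 - lam / 2) /
        Real.Gamma ((n + lam) / 2) * ‖d‖ ^ lam) := by
  have hn' : (1 : ℝ) ≤ n := by exact_mod_cast hn
  have hnl : 0 < (n : ℝ) + lam := by linarith
  have : Nonempty (Fin n) := ⟨⟨0, hn⟩⟩
  have hd' := norm_pos_iff.2 hd
  have hΓ1 := Real.Gamma_pos_of_pos (show 0 < ((n : ℝ) + lam) / 2 by linarith)
  have hΓ2 := Real.Gamma_pos_of_pos (show 0 < 1 - lam / 2 by linarith)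
  set c := Real.pi ^ (((n : ℝ) + lam) / 2) / Real.Gamma ((n + lam) / 2) with hc
  have hcos : ∀ s : E n, 0 ≤ 2 - 2 * Real.cos (2 * Real.pi * inner ℝ d s) := fun s => by
    linarith [Real.cos_le_one (2 * Real.pi * inner ℝ d s)]
  calc _ = ∫⁻ s : E n, ENNReal.ofReal c * ∫⁻ t, powKernel ((n + lam) / 2) t *
        ENNReal.ofReal (Real.exp (-(Real.pi * t * ‖s‖ ^ 2)) *
          (2 - 2 * Real.cos (2 * Real.pi * inner ℝ d s))) := by
        refine lintegral_congr_ae ?_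
        filter_upwards [compl_mem_ae_iff.2 (measure_singleton (0 : E n))] with s hs
        rw [show -(n : ℝ) - lam = -(n + lam) by ring,
          ofReal_rpow_neg_eq hnl (norm_pos_iff.2 hs), mul_assoc, ← lintegral_mul_const _ (by fun_prop)]
        congr 1
        refine lintegral_congr fun t => ?_
        rw [ENNReal.ofReal_mul (Real.exp_pos _).le, mul_assoc]
        congr 5; ring
    _ = ENNReal.ofReal c * ∫⁻ t, powKernel ((n + lam) / 2) t *
        ∫⁻ s : E n, ENNReal.ofReal (Real.exp (-(Real.pi * t * ‖s‖ ^ 2)) *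
          (2 - 2 * Real.cos (2 * Real.pi * inner ℝ d s))) := by
        rw [lintegral_const_mul' _ _ ofReal_ne_top, lintegral_lintegral_swap (by fun_prop)]
        congr 1
        refine lintegral_congr fun t => ?_
        rw [lintegral_const_mul _ (by fun_prop)]
    _ = ENNReal.ofReal c * ∫⁻ t in Ioi (0 : ℝ), ENNReal.ofReal 2 *
          ENNReal.ofReal (t ^ (lam / 2 - 1) *
            (1 - Real.exp (-(Real.pi * ‖d‖ ^ 2 / t)))) := by
        rw [lintegral_powKernel_mul]
        congr 1
        refine setLIntegral_congr_fun measurableSet_Ioi fun t ht => ?_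
        have ht : (0 : ℝ) < t := ht
        rw [lintegral_gaussian_mul_one_sub_cos ht, ← ENNReal.ofReal_mul (by positivity),
          ← ENNReal.ofReal_mul (by positivity)]
        congr 1
        rw [show lam / 2 - 1 = ((n + lam) / 2 - 1) + -(n : ℝ) / 2 by ring, Real.rpow_add ht]
        ring
    _ = _ := by
        rw [lintegral_const_mul' _ _ ofReal_ne_top,
          lintegral_rpow_mul_one_sub_exp (half_pos hl) (by linarith) (by positivity),
          ← ENNReal.ofReal_mul (by positivity), ← ENNReal.ofReal_mul (by positivity)]
        congr 1
        rw [hc, Real.mul_rpow Real.pi_pos.le (by positivity), ← Real.rpow_natCast,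
          ← Real.rpow_mul hd'.le, show ((2 : ℕ) : ℝ) * (lam / 2) = lam by push_cast; ring,
          show (n : ℝ) / 2 + lam = (n + lam) / 2 + lam / 2 by ring, Real.rpow_add Real.pi_pos]
        field_simp
        ring

lemma planePoint_eq (z : E n × E n) (s : E n) :
    planePoint z s = z + antidiag ((Real.sqrt 2)⁻¹ • s) := by
  ext1 <;> simp [planePoint, antidiag, sub_eq_add_neg]

lemma differenceDensity_planePoint (lam : ℝ) (f : E n × E n → ℂ) (z : E n × E n) (s : E n) :
    differenceDensity lam f z (planePoint z s) =
      Real.sqrt 2 ^ (-(n : ℝ) - lam) * ‖s‖ ^ (-(n : ℝ) - lam) *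
        ‖f z - f (z + antidiag ((Real.sqrt 2)⁻¹ • s))‖ ^ 2 := by
  rw [← planePoint_eq, differenceDensity, ← Real.mul_rpow (by positivity) (by positivity)]
  congr 2
  have h : z.1 - z.2 - (planePoint z s).1 + (planePoint z s).2 = -(Real.sqrt 2 • s) := by
    have h2 : Real.sqrt 2 = (Real.sqrt 2)⁻¹ + (Real.sqrt 2)⁻¹ := by
      have := Real.mul_self_sqrt (show (0 : ℝ) ≤ 2 by norm_num)
      field_simp; linarith
    conv_rhs => rw [h2, add_smul]
    simp only [planePoint]
    abel
  rw [h, norm_neg, norm_smul, Real.norm_of_nonneg (by positivity)]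

lemma differenceDensity_nonneg (lam : ℝ) (f : E n × E n → ℂ) (z z' : E n × E n) :
    0 ≤ differenceDensity lam f z z' := by
  unfold differenceDensity; positivity

lemma constG_pos (hn : 1 ≤ n) {lam : ℝ} (hl : 0 < lam) (hl2 : lam < 2) (hln : lam < n) :
    0 < constG n lam := by
  have h1 := Real.Gamma_pos_of_pos (show 0 < ((n : ℝ) - lam) / 4 by linarith)
  have h2 := Real.Gamma_pos_of_pos (show 0 < ((n : ℝ) + lam) / 4 by linarith)
  have h3 := Real.Gamma_pos_of_pos (show 0 < ((n : ℝ) + lam) / 2 by linarith)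
  have h4 := Real.Gamma_pos_of_pos (show 0 < 1 - lam / 2 by linarith)
  unfold constG; positivity

/-- The value `F_lam / G_lam`. -/
lemma constG_mul {lam : ℝ} (hl : 0 < lam) (hl2 : lam < 2) (hln : lam < n) :
    constG n lam * (Real.sqrt 2 ^ (-(n : ℝ) - lam) *
      (4 / lam * Real.pi ^ ((n : ℝ) / 2 + lam) * Real.Gamma (1 - lam / 2) /
        Real.Gamma ((n + lam) / 2) * (Real.sqrt 2)⁻¹ ^ lam)) = constF n lam := by
  have h3 := Real.Gamma_pos_of_pos (show 0 < ((n : ℝ) + lam) / 2 by linarith)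
  have h4 := Real.Gamma_pos_of_pos (show 0 < 1 - lam / 2 by linarith)
  -- The kernel sees `√2 s` while the translation is by `s/√2`; these give `√2^(-n-lam)` and
  -- `√2^(-lam)` respectively.
  have e1 : Real.sqrt 2 ^ (-(n : ℝ) - lam) * (Real.sqrt 2)⁻¹ ^ lam =
      2 ^ (-(n : ℝ) / 2) * (2 ^ lam)⁻¹ := by
    rw [Real.inv_rpow (by positivity), ← Real.rpow_neg (by positivity),
      ← Real.rpow_neg (by positivity), ← Real.rpow_add (by positivity), Real.sqrt_eq_rpow,
      ← Real.rpow_mul (by positivity), ← Real.rpow_add (by positivity)]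
    congr 1; ring
  have e2 : (Real.pi / 2) ^ (-(n : ℝ) / 2) * Real.pi ^ ((n : ℝ) / 2 + lam) *
      (2 ^ (-(n : ℝ) / 2) * (2 ^ lam)⁻¹) = (Real.pi / 2) ^ lam := by
    rw [Real.div_rpow Real.pi_pos.le (by positivity), Real.div_rpow Real.pi_pos.le (by positivity),
      Real.rpow_add Real.pi_pos, neg_div, Real.rpow_neg Real.pi_pos.le]
    field_simp
  rw [constF, ← e2, ← e1, constG]
  generalize Real.Gamma (1 - lam / 2) = a at *
  field_simp

/-- An exact identity: integrate in `z` first by Plancherel for a fixed `s`, exchange, and evaluate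
the `s`-integral at each frequency with `d = (ξ-η)/√2`. -/
lemma lintegral_differenceDensity_planePoint (hn : 1 ≤ n) {lam : ℝ} (hl : 0 < lam)
    (hl2 : lam < 2) (hln : lam < n) (f : 𝓢(E n × E n, ℂ)) :
    ENNReal.ofReal (constG n lam) * ∫⁻ q : (E n × E n) × E n,
        ENNReal.ofReal (differenceDensity lam f q.1 (planePoint q.1 q.2)) =
      ENNReal.ofReal (constF n lam) * ∫⁻ w, ENNReal.ofReal (frequencyDensity lam f w) := by
  have mf := f.continuous.measurable
  have mh := (hat f).continuous.measurable
  have h3 := Real.Gamma_pos_of_pos (show 0 < ((n : ℝ) + lam) / 2 by linarith)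
  have h4 := Real.Gamma_pos_of_pos (show 0 < 1 - lam / 2 by linarith)
  set c := Real.sqrt 2 ^ (-(n : ℝ) - lam) with hc
  have hc0 : 0 ≤ c := by positivity
  set K := 4 / lam * Real.pi ^ ((n : ℝ) / 2 + lam) * Real.Gamma (1 - lam / 2) /
        Real.Gamma ((n + lam) / 2) with hK
  have hK0 : 0 ≤ K := by positivity
  rw [← constG_mul hl hl2 hln, ENNReal.ofReal_mul (constG_pos hn hl hl2 hln).le, mul_assoc]
  congr 1
  simp only [differenceDensity_planePoint, ← hc]
  rw [Measure.volume_eq_prod, lintegral_prod_symm' _ (by fun_prop)]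
  have hcos : ∀ x : ℝ, 0 ≤ 2 - 2 * Real.cos x := fun x => by linarith [Real.cos_le_one x]
  have e1 : ∀ s : E n, ∫⁻ z, ENNReal.ofReal (c * ‖s‖ ^ (-(n : ℝ) - lam) *
        ‖f z - f (z + antidiag ((Real.sqrt 2)⁻¹ • s))‖ ^ 2) =
      ∫⁻ w : E n × E n, ENNReal.ofReal (c * ‖hat f w‖ ^ 2) *
        (ENNReal.ofReal (‖s‖ ^ (-(n : ℝ) - lam)) * ENNReal.ofReal
        (2 - 2 * Real.cos (2 * Real.pi * inner ℝ ((Real.sqrt 2)⁻¹ • (w.1 - w.2)) s))) := by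
    intro s
    have h0 : 0 ≤ c * ‖s‖ ^ (-(n : ℝ) - lam) := by positivity
    simp only [ENNReal.ofReal_mul h0]
    rw [lintegral_const_mul' _ _ ofReal_ne_top, ← ofReal_integral_eq_lintegral_ofReal
      (integrable_norm_sub_translate_sq f _) (ae_of_all _ fun z => by positivity),
      integral_norm_sub_translate_sq, ofReal_integral_eq_lintegral_ofReal,
      ← lintegral_const_mul' _ _ ofReal_ne_top]
    · refine lintegral_congr fun w => ?_
      rw [← ENNReal.ofReal_mul h0, ← ENNReal.ofReal_mul (by positivity),
        ← ENNReal.ofReal_mul (by positivity), dot_antidiag, inner_smul_right,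
        real_inner_smul_left]
      congr 1; ring
    · refine (((integrable_norm_sq (hat f)).const_mul 2).sub
        ((integrable_norm_sq_hat_mul f (antidiag ((Real.sqrt 2)⁻¹ • s))).const_mul 2)).congr (ae_of_all _ fun w => ?_)
      simp only [Pi.sub_apply]; ring
    · exact ae_of_all _ fun w => mul_nonneg (by positivity) (hcos _)
  simp only [e1]
  rw [lintegral_lintegral_swap (by fun_prop), ← lintegral_const_mul' _ _ ofReal_ne_top]
  refine lintegral_congr_ae ?_
  filter_upwards [ae_fst_ne_snd hn] with w hw
  have hd : (Real.sqrt 2)⁻¹ • (w.1 - w.2) ≠ 0 :=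
    smul_ne_zero (by positivity) (sub_ne_zero.2 hw)
  rw [lintegral_const_mul' _ _ ofReal_ne_top, lintegral_norm_rpow_mul_one_sub_cos hn hl hl2 hd,
    ← hK, ← ENNReal.ofReal_mul (by positivity), ← ENNReal.ofReal_mul (by positivity),
    frequencyDensity, ← hat_eq_fourier, norm_smul, Real.norm_of_nonneg (by positivity),
    Real.mul_rpow (by positivity) (norm_nonneg _)]
  congr 1; ring

lemma integrable_differenceDensity_planePoint (hn : 1 ≤ n) {lam : ℝ} (hl : 0 < lam)
    (hl2 : lam < 2) (hln : lam < n) (f : 𝓢(E n × E n, ℂ)) :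
    Integrable fun q : (E n × E n) × E n =>
      differenceDensity lam f q.1 (planePoint q.1 q.2) := by
  refine ⟨Measurable.aestronglyMeasurable ?_, ?_⟩
  · have := f.continuous.measurable
    simp only [differenceDensity_planePoint]
    fun_prop
  · rw [hasFiniteIntegral_iff_ofReal (ae_of_all _ fun q => differenceDensity_nonneg lam f _ _)]
    have h := lintegral_differenceDensity_planePoint hn hl hl2 hln f
    rw [lintegral_frequencyDensity hl.le] at h
    by_contra! h2
    rw [top_le_iff.1 h2, ENNReal.mul_top (ENNReal.ofReal_pos.2 (constG_pos hn hl hl2 hln)).ne',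
      ← ENNReal.ofReal_mul (constF_pos hl hln).le] at h
    exact ofReal_ne_top h.symm

/-- The difference functional over the planes controls the potential energy. -/
theorem integral_potentialDensity_le_difference (hn : 1 ≤ n) {lam : ℝ} (hl : 0 < lam)
    (hl2 : lam < 2) (hln : lam < n) (f : 𝓢(E n × E n, ℂ)) :
    ∫ z, potentialDensity lam f z ≤ constG n lam * ∫ q : (E n × E n) × E n,
      differenceDensity lam f q.1 (planePoint q.1 q.2) := by
  have hG := constG_pos hn hl hl2 hln
  have h0 : 0 ≤ ∫ q : (E n × E n) × E n, differenceDensity lam f q.1 (planePoint q.1 q.2) :=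
    integral_nonneg fun q => differenceDensity_nonneg lam f _ _
  refine (ENNReal.ofReal_le_ofReal_iff (mul_nonneg hG.le h0)).1 ?_
  rw [ENNReal.ofReal_mul hG.le, ofReal_integral_eq_lintegral_ofReal
    (integrable_differenceDensity_planePoint hn hl hl2 hln f)
    (ae_of_all _ fun q => differenceDensity_nonneg lam f _ _),
    lintegral_differenceDensity_planePoint hn hl hl2 hln,
    ofReal_integral_eq_lintegral_ofReal (integrable_potentialDensity hn hl hln f)
    (ae_of_all _ (potentialDensity_nonneg lam f))]
  exact lintegral_pitt hn hl hln f

/-! ### The difference functional over the whole space -/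

/-- Each slice at fixed second coordinate is a unit ball, and there are infinitely many slices in
measure: the slab is invariant under diagonal translations. -/
lemma volume_sub_mem_ball (hn : 1 ≤ n) (a : E n) :
    volume {z : E n × E n | z.1 - z.2 ∈ Metric.ball a 1} = ⊤ := by
  have : Nonempty (Fin n) := ⟨⟨0, hn⟩⟩
  have hm : MeasurableSet {z : E n × E n | z.1 - z.2 ∈ Metric.ball a 1} :=
    (Metric.isOpen_ball.preimage (by fun_prop : Continuous fun z : E n × E n => z.1 - z.2)).measurableSet
  rw [Measure.volume_eq_prod, Measure.prod_apply_symm hm]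
  have h : ∀ y : E n, volume ((fun x => (x, y)) ⁻¹' {z : E n × E n | z.1 - z.2 ∈ Metric.ball a 1}) =
      volume (Metric.ball (0 : E n) 1) := by
    intro y
    rw [← Measure.addHaar_ball_center volume (a + y)]
    congr 1
    ext x
    simp only [mem_preimage, mem_ofPred_eq, Metric.mem_ball, dist_eq_norm]
    rw [show x - y - a = x - (a + y) by abel]
  simp only [h]
  rw [lintegral_const, measure_univ_of_isAddLeftInvariant, ENNReal.mul_top]
  exact (Metric.measure_ball_pos volume 0 one_pos).ne'

/-- The kernel is constant along the diagonal directions, so that the difference functional over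
the whole space is infinite unless `f = 0`. -/
lemma lintegral_differenceDensity_eq_top (hn : 1 ≤ n) {lam : ℝ} (hl : 0 < lam)
    (f : 𝓢(E n × E n, ℂ)) {z₀ : E n × E n} (hz₀ : f z₀ ≠ 0) :
    ∫⁻ q : (E n × E n) × (E n × E n), ENNReal.ofReal (differenceDensity lam f q.1 q.2) = ⊤ := by
  have : Nonempty (Fin n) := ⟨⟨0, hn⟩⟩
  set c := ‖f z₀‖ with hc
  have hc0 : 0 < c := norm_pos_iff.2 hz₀
  obtain ⟨r, hr0, hr⟩ : ∃ r > 0, ∀ z ∈ Metric.ball z₀ r, c / 2 < ‖f z‖ :=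
    Metric.eventually_nhds_iff_ball.1
      (f.continuous.norm.continuousAt.eventually (lt_mem_nhds (half_lt_self hc0)))
  obtain ⟨C, hC0, hC⟩ := f.decay 1 0
  simp only [pow_one, norm_iteratedFDeriv_zero] at hC
  -- Between `B` and `S` the difference variable deviates from `e` by less than `1 + 1 + 1 = 3`, so
  -- norm 4 keeps the kernel's argument between 1 and 7. It must stay off zero, where a negative
  -- power is 0 by convention.
  obtain ⟨e, he⟩ := exists_norm_eq (E n) (show (0 : ℝ) ≤ 4 by norm_num)
  set a := z₀.1 - z₀.2 + e with ha
  -- Beyond radius `R` the decay bound `‖w‖ ‖f w‖ ≤ C` forces `‖f w‖ ≤ c/4`, against `‖f z‖ > c/2`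
  -- on `B`. Removing this ball from the slab costs only finite measure.
  set R := 4 * C / c with hR
  set S := {z : E n × E n | z.1 - z.2 ∈ Metric.ball a 1} \ Metric.closedBall 0 R with hS
  have hSm : MeasurableSet S :=
    (Metric.isOpen_ball.preimage
      (by fun_prop : Continuous fun z : E n × E n => z.1 - z.2)).measurableSet.diff
      Metric.isClosed_closedBall.measurableSet
  have hSv : volume S = ⊤ := by
    refine top_le_iff.1 (le_trans ?_ (le_measure_sdiff (μ := volume)))
    rw [volume_sub_mem_ball hn, ENNReal.top_sub measure_closedBall_lt_top.ne]
  set B := Metric.ball z₀ (min r 1) with hB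
  have hBv : volume B ≠ 0 := (Metric.measure_ball_pos volume _ (lt_min hr0 one_pos)).ne'
  set δ := (7 : ℝ) ^ (-(n : ℝ) - lam) * (c / 4) ^ 2 with hδ
  have hδ0 : 0 < δ := by positivity
  have key : ∀ q ∈ B ×ˢ S, ENNReal.ofReal δ ≤ ENNReal.ofReal (differenceDensity lam f q.1 q.2) := by
    rintro ⟨z, w⟩ ⟨hz, hw, hw'⟩
    refine ENNReal.ofReal_le_ofReal ?_
    have hz1 : dist z z₀ < 1 := lt_of_lt_of_le hz (min_le_right _ _)
    have hz2 := hr z (Metric.ball_subset_ball (min_le_left _ _) hz)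
    rw [dist_eq_norm] at hz1
    have hz3 := (norm_fst_le (z - z₀)).trans_lt hz1
    have hz4 := (norm_snd_le (z - z₀)).trans_lt hz1
    simp only [mem_ofPred_eq, Metric.mem_ball, dist_eq_norm] at hw
    simp only [Metric.mem_closedBall, dist_zero_right, not_le] at hw'
    have hw2 : ‖f w‖ ≤ c / 4 := by
      have h1 : R * ‖f w‖ ≤ C := (mul_le_mul_of_nonneg_right hw'.le (norm_nonneg _)).trans (hC w)
      rw [hR] at h1
      have h2 : 4 * C / c * ‖f w‖ = C * (4 * ‖f w‖ / c) := by ring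
      rw [h2] at h1
      have h3 : 4 * ‖f w‖ / c ≤ 1 := le_of_mul_le_mul_left (by linarith) hC0
      rw [div_le_one hc0] at h3
      linarith
    have hx : z.1 - z.2 - w.1 + w.2 =
        (z - z₀).1 - (z - z₀).2 - (w.1 - w.2 - a) - e := by
      simp only [ha, Prod.fst_sub, Prod.snd_sub]; abel
    have hx1 : ‖(z - z₀).1 - (z - z₀).2 - (w.1 - w.2 - a)‖ < 3 := by
      have h1 := norm_sub_le ((z - z₀).1 - (z - z₀).2) (w.1 - w.2 - a)
      have h2 := norm_sub_le (z - z₀).1 (z - z₀).2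
      linarith
    have hx2 : ‖z.1 - z.2 - w.1 + w.2‖ ≤ 7 := by
      rw [hx]
      exact (norm_sub_le _ _).trans (by linarith)
    have hx3 : 0 < ‖z.1 - z.2 - w.1 + w.2‖ := by
      rw [hx, norm_sub_rev]
      exact lt_of_lt_of_le (by linarith) (norm_sub_norm_le _ _)
    have hf : c / 4 ≤ ‖f z - f w‖ := by
      have := norm_sub_norm_le (f z) (f w)
      linarith
    simp only [differenceDensity, hδ]
    gcongr ?_ * ?_ ^ 2
    exact Real.rpow_le_rpow_of_nonpos hx3 hx2 (by
      have : (0 : ℝ) ≤ n := n.cast_nonneg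
      linarith)
  refine top_le_iff.1 ?_
  calc (⊤ : ℝ≥0∞) = ENNReal.ofReal δ * volume (B ×ˢ S) := by
        rw [Measure.volume_eq_prod, Measure.prod_prod, hSv, ENNReal.mul_top hBv,
          ENNReal.mul_top (ENNReal.ofReal_pos.2 hδ0).ne']
    _ = ∫⁻ q in B ×ˢ S, ENNReal.ofReal δ := (setLIntegral_const _ _).symm
    _ ≤ ∫⁻ q in B ×ˢ S, ENNReal.ofReal (differenceDensity lam f q.1 q.2) :=
        setLIntegral_mono' (Metric.isOpen_ball.measurableSet.prod hSm) key
    _ ≤ _ := setLIntegral_le_lintegral _ _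

/-- A dichotomy: either `f` vanishes identically or the right side is infinite. -/
theorem ofReal_potentialDensity_le_lintegral_difference (hn : 1 ≤ n) {lam : ℝ} (hl : 0 < lam)
    (hl2 : lam < 2) (hln : lam < n) (f : 𝓢(E n × E n, ℂ)) :
    ENNReal.ofReal (∫ z, potentialDensity lam f z) ≤ ENNReal.ofReal (constG n lam) *
      ∫⁻ q : (E n × E n) × (E n × E n), ENNReal.ofReal (differenceDensity lam f q.1 q.2) := by
  by_cases h : ∃ z₀, f z₀ ≠ 0
  · obtain ⟨z₀, hz₀⟩ := h
    rw [lintegral_differenceDensity_eq_top hn hl f hz₀,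
      ENNReal.mul_top (ENNReal.ofReal_pos.2 (constG_pos hn hl hl2 hln)).ne']
    exact le_top
  · push Not at h
    simp [potentialDensity, h]

end PittAS

theorem mainTheorem10 (n : ℕ) (hn : 1 ≤ n) (f : 𝓢(PittAS.E n × PittAS.E n, ℂ)) :
    -- Pitt's inequality for the difference variable
    (∀ lam : ℝ, 0 < lam → lam < n →
      Integrable (PittAS.potentialDensity lam f) ∧
      Integrable (PittAS.frequencyDensity lam f) ∧
      ∫ z, PittAS.potentialDensity lam f z ≤
        PittAS.constF n lam * ∫ w, PittAS.frequencyDensity lam f w) ∧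
    -- the form with the nonlocal difference functional
    (∀ lam : ℝ, 0 < lam → lam < min 2 (n : ℝ) →
      Integrable (fun q : (PittAS.E n × PittAS.E n) × PittAS.E n =>
        PittAS.differenceDensity lam f q.1 (PittAS.planePoint q.1 q.2)) ∧
      ∫ z, PittAS.potentialDensity lam f z ≤
        PittAS.constG n lam *
          ∫ q : (PittAS.E n × PittAS.E n) × PittAS.E n,
            PittAS.differenceDensity lam f q.1 (PittAS.planePoint q.1 q.2) ∧
      ENNReal.ofReal (∫ z, PittAS.potentialDensity lam f z) ≤
        ENNReal.ofReal (PittAS.constG n lam) *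
          ∫⁻ q : (PittAS.E n × PittAS.E n) × (PittAS.E n × PittAS.E n),
            ENNReal.ofReal (PittAS.differenceDensity lam f q.1 q.2)) ∧
    -- the logarithmic uncertainty inequality
    (Integrable (fun z : PittAS.E n × PittAS.E n =>
        Real.log ‖z.1 - z.2‖ * ‖f z‖ ^ 2) ∧
      Integrable (fun w : PittAS.E n × PittAS.E n =>
        Real.log ‖w.1 - w.2‖ * ‖PittAS.fourier f w‖ ^ 2) ∧
      (PittAS.psi ((n : ℝ) / 4) - Real.log (Real.pi / 2)) * ∫ z, ‖f z‖ ^ 2 ≤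
        (∫ z : PittAS.E n × PittAS.E n, Real.log ‖z.1 - z.2‖ * ‖f z‖ ^ 2) +
        ∫ w : PittAS.E n × PittAS.E n,
          Real.log ‖w.1 - w.2‖ * ‖PittAS.fourier f w‖ ^ 2) := by
  refine ⟨fun lam hl hln => ⟨PittAS.integrable_potentialDensity hn hl hln f,
    PittAS.integrable_frequencyDensity hl.le f, PittAS.integral_pitt hn hl hln f⟩,
    fun lam hl hlm => ?_, (PittAS.hasDerivAt_integral_rpow hn f).1, ?_,
    PittAS.log_uncertainty hn f⟩
  · have hl2 := hlm.trans_le (min_le_left _ _)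
    have hln := hlm.trans_le (min_le_right _ _)
    exact ⟨PittAS.integrable_differenceDensity_planePoint hn hl hl2 hln f,
      PittAS.integral_potentialDensity_le_difference hn hl hl2 hln f,
      PittAS.ofReal_potentialDensity_le_lintegral_difference hn hl hl2 hln f⟩
  · simpa only [PittAS.hat_eq_fourier] using (PittAS.hasDerivAt_integral_rpow hn (PittAS.hat f)).1
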